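/- Let $G$ be a compact connected semisimple Lie group and let $K\subset G$ be a compact connected symmetric subgroup, i.e. there is an involutive automorphism $\sigma$ of $G$ such that $K$ is an open subgroup of the fixed point group $G^\sigma$. Let $T_K\subset K$ and $T_G\subset G$ be maximal tori with $T_K\subset T_G$, and let $\mathfrak t_{\mathfrak k}\subset\mathfrak t_{\mathfrak g}$ be the Lie algebras of $T_K$ and $T_G$, regarded as subspaces of the Lie algebra $\mathfrak g$ of $G$. Let $\Delta_{\mathfrak g}\subset\mathfrak t_{\mathfrak g}^*$ be the root system of $G$ with respect to $T_G$, i.e. the set of nonzero $\alpha\in\mathfrak t_{\mathfrak g}^*$ for which $\{X\in\mathfrak g^{\mathbb C}\mid [W,X]=i\alpha(W)X\text{ for all }W\in\mathfrak t_{\mathfrak g}\}\neq 0$, and put $\Delta_{\mathfrak g}|_{\mathfrak t_{\mathfrak k}}=\{\alpha|_{\mathfrak t_{\mathfrak k}}\mid\alpha\in\Delta_{\mathfrak g}\}\subset \mathfrak t_{\mathfrak k}^*$. For a set $\Phi$ of linear forms on a finite-dimensional real vector space $V$, the $\Phi$-Weyl chambers are the connected components of $V\setminus\bigcup_{\alpha\in\Phi}\ker\alpha$;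 the set of simple roots of $\Phi$ corresponding to a chamber $D$ is the set of those $\alpha\in\Phi$ that are positive on $D$ and are not the sum of two elements of $\Phi$ that are positive on $D$. The $\Delta_{\mathfrak g}$-Weyl chambers in $\mathfrak t_{\mathfrak g}$ are called $\mathfrak g$-Weyl chambers, and the nonempty intersections $C\cap\mathfrak t_{\mathfrak k}$ of $\mathfrak g$-Weyl chambers $C$ with $\mathfrak t_{\mathfrak k}$ are called compartments. Then the $\Delta_{\mathfrak g}|_{\mathfrak t_{\mathfrak k}}$-Weyl chambers are exactly the compartments. Moreover, if $C$ is a $\mathfrak g$-Weyl chamber with $C\cap\mathfrak t_{\mathfrak k}\neq\emptyset$, and $B\subset\Delta_{\mathfrak g}$ is the corresponding set of simple roots, then $B|_{\mathfrak t_{\mathfrak k}}=\{\alpha|_{\mathfrak t_{\mathfrak k}}\mid\alpha\in B\}$ is the set of simple roots of $\Delta_{\mathfrak g}|_{\mathfrak t_{\mathfrak k}}$ corresponding to $C\cap\mathfrak t_{\mathfrak k}$. -/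

import Mathlib

open scoped Manifold ContDiff TensorProduct

noncomputable section

/-! ### Roots, Weyl chambers, simple roots -/

section Chambers

/-- The root space `{X ∈ L ⊗ ℂ | [W, X] = i α(W) X for all W ∈ t}` of a linear form `α` on a
subspace `t` of a real Lie algebra `L`, in the complexification of `L`. -/
def complexRootSpace {L : Type*} [LieRing L] [LieAlgebra ℝ L] (t : Submodule ℝ L)
    (α : Module.Dual ℝ t) : Submodule ℂ (ℂ ⊗[ℝ] L) :=
  ⨅ W : t, Module.End.eigenspace (LieAlgebra.ad ℂ (ℂ ⊗[ℝ] L) ((1 : ℂ) ⊗ₜ[ℝ] (W : L)))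
    (Complex.I * (α W : ℂ))

/-- The (real) roots of `L` with respect to `t`: the nonzero linear forms on `t` whose root space
is nonzero. -/
def realRoots {L : Type*} [LieRing L] [LieAlgebra ℝ L] (t : Submodule ℝ L) :
    Set (Module.Dual ℝ t) :=
  {α | α ≠ 0 ∧ complexRootSpace t α ≠ ⊥}

/-- The points of `V` at which no element of `Φ` vanishes: `V \ ⋃ α ∈ Φ, ker α`. -/
def regularSet {V : Type*} [AddCommGroup V] [Module ℝ V] (Φ : Set (Module.Dual ℝ V)) : Set V :=
  (⋃ α ∈ Φ, (LinearMap.ker α : Set V))ᶜ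

/-- The Weyl chambers of `Φ`: the connected components of `V \ ⋃ α ∈ Φ, ker α`. -/
def weylChambers {V : Type*} [AddCommGroup V] [Module ℝ V] [TopologicalSpace V]
    (Φ : Set (Module.Dual ℝ V)) : Set (Set V) :=
  {C | ∃ x ∈ regularSet Φ, C = connectedComponentIn (regularSet Φ) x}

/-- The elements of `Φ` that are positive with respect to `C`, i.e. positive at all points
of `C`. -/
def positiveRoots {V : Type*} [AddCommGroup V] [Module ℝ V] (Φ : Set (Module.Dual ℝ V))
    (C : Set V) : Set (Module.Dual ℝ V) :=
  {α | α ∈ Φ ∧ ∀ x ∈ C, 0 < α x}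

/-- The simple roots of `Φ` corresponding to the chamber `C`: the positive roots that are not
the sum of two positive roots. -/
def simpleRoots {V : Type*} [AddCommGroup V] [Module ℝ V] (Φ : Set (Module.Dual ℝ V))
    (C : Set V) : Set (Module.Dual ℝ V) :=
  {α | α ∈ positiveRoots Φ C ∧
    ¬ ∃ β ∈ positiveRoots Φ C, ∃ γ ∈ positiveRoots Φ C, α = β + γ}

/-- For subspaces `s ≤ t`, the restriction to `s` of a linear form on `t`. -/
def restrictForm {L : Type*} [AddCommGroup L] [Module ℝ L] {s t : Submodule ℝ L} (h : s ≤ t)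
    (α : Module.Dual ℝ t) : Module.Dual ℝ s :=
  α.comp (Submodule.inclusion h)

/-- For subspaces `s ≤ t` and `C ⊆ t`, the intersection `C ∩ s` as a subset of `s`. -/
def interSubspace {L : Type*} [AddCommGroup L] [Module ℝ L] {s t : Submodule ℝ L} (h : s ≤ t)
    (C : Set t) : Set s :=
  Submodule.inclusion h ⁻¹' C

/-- For subspaces `s ≤ t`, the compartments of `Φ` in `s`: the nonempty intersections with `s`
of the Weyl chambers of `Φ` in `t`. -/
def compartments {L : Type*} [AddCommGroup L] [Module ℝ L] [TopologicalSpace L]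
    {s t : Submodule ℝ L} (h : s ≤ t) (Φ : Set (Module.Dual ℝ t)) : Set (Set s) :=
  {D | D.Nonempty ∧ ∃ C ∈ weylChambers Φ, D = interSubspace h C}

end Chambers

/-! ### Symmetric subgroups and maximal tori of Lie groups -/

section Groups

/-- Smooth real Lie groups have the regularity needed for the Lie bracket on the tangent space
at the identity. -/
instance instLEInftyMinSmoothness : ENat.LEInfty (minSmoothness ℝ 3) :=
  ⟨by rw [minSmoothness_of_isRCLikeNormedField]; exact ENat.LEInfty.out⟩

variable {E : Type*} [NormedAddCommGroup E] [NormedSpace ℝ E]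
  {G : Type*} [TopologicalSpace G] [ChartedSpace E G] [Group G]

/-- `K` is a symmetric subgroup of `G`: for some involutive (smooth) automorphism `σ` of `G`,
it is an open subgroup of the fixed point group of `σ`. -/
def IsSymmetricSubgroup (E : Type*) [NormedAddCommGroup E] [NormedSpace ℝ E]
    {G : Type*} [TopologicalSpace G] [ChartedSpace E G] [Group G] (K : Subgroup G) : Prop :=
  ∃ σ : G ≃* G, ContMDiff 𝓘(ℝ, E) 𝓘(ℝ, E) ∞ σ ∧ (∀ g, σ (σ g) = g) ∧
    ∃ U : Set G, IsOpen U ∧ (K : Set G) = U ∩ {g | σ g = g}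

/-- A torus in a Lie group: a compact connected abelian subgroup (being closed, it is
automatically a Lie subgroup). -/
def IsTorus {G : Type*} [TopologicalSpace G] [Group G] (T : Subgroup G) : Prop :=
  IsCompact (T : Set G) ∧ IsConnected (T : Set G) ∧ ∀ x ∈ T, ∀ y ∈ T, x * y = y * x

/-- `T` is a maximal torus of the subgroup `H`. -/
def IsMaximalTorus {G : Type*} [TopologicalSpace G] [Group G] (T H : Subgroup G) : Prop :=
  Maximal (fun S : Subgroup G => IsTorus S ∧ S ≤ H) T

/-- The Lie algebra, inside that of `G`, of a closed subgroup `H` of the Lie group `G`. It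
consists of the `X` such that `exp (t X) ∈ H` for all real `t`, where `t ↦ exp (t X)` is the
integral curve through `1` of the left invariant vector field with value `X` at `1`. These `X`
already form a subspace when `H` is closed, so that the span adds nothing. -/
def subgroupLieAlgebra (E : Type*) [NormedAddCommGroup E] [NormedSpace ℝ E]
    {G : Type*} [TopologicalSpace G] [ChartedSpace E G] [Group G] (H : Subgroup G) :
    Submodule ℝ (GroupLieAlgebra 𝓘(ℝ, E) G) :=
  Submodule.span ℝ {X | ∃ γ : ℝ → G, γ 0 = 1 ∧
    IsMIntegralCurve (I := 𝓘(ℝ, E)) γ (mulInvariantVectorField X) ∧ ∀ t, γ t ∈ H}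

theorem subgroupLieAlgebra_mono {H H' : Subgroup G} (h : H ≤ H') :
    subgroupLieAlgebra E H ≤ subgroupLieAlgebra E H' :=
  Submodule.span_mono fun _ ⟨γ, h0, hγ, hH⟩ => ⟨γ, h0, hγ, fun t => h (hH t)⟩

end Groups

end

/-! The chamber statement is pure hyperplane geometry: a chamber is cut out by the signs of the
forms, and restricting to a subspace does not change signs
(`weylChambers_restrictForm_eq_compartments`).

For simple roots, the danger is that several roots share a restriction, so that a simple root might
become a sum after restriction. This cannot happen once `t_k` contains a point `x` at which every
simple root equals 1: every positive root is then at least 1 at `x`, and a sum of two is at least 2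
(`restrictForm_image_simpleRoots`).

To find `x`, fix an invariant inner product on `g` and let `θ` be the differential of `σ`. The
centralizer of `t_k` in `g` is `t_g` (`mem_of_forall_lie_eq_zero_of_involution`), so `θ` preserves
`t_g` and permutes the roots. It fixes the points of `C ∩ t_k`, hence permutes the positive and the
simple roots of `C`. Simple roots are linearly independent, because they make non-acute angles and
lie in an open half space; so some `y` in `t_g` has all simple roots equal to 1, and so does `(y + θ
y) / 2`, which lies in `t_k`.

The rest links groups to algebras: the Lie algebra of a maximal torus of a symmetric subgroup is its
own centralizer in the fixed points of `θ` (`mem_subgroupLieAlgebra_iff_forall_lie_eq_zero`). The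
delicate point is that a vector centralized by the Lie algebra of `T` is fixed by `Ad T`. This is
proved in the linear group `Ad T`: near the identity it consists of exponentials of generators of
its one-parameter subgroups. Such generators are derivations, hence inner by semisimplicity, and
they come from the Lie algebra of `T`. -/

open scoped Manifold ContDiff TensorProduct

noncomputable section

/-! ### Roots and root vectors in real terms -/

section RealRoots

variable {L : Type*} [LieRing L] [LieAlgebra ℝ L]

theorem exists_eq_one_tmul_add_I_tmul {V : Type*} [AddCommGroup V] [Module ℝ V]
    (z : ℂ ⊗[ℝ] V) : ∃ x y : V, z = (1 : ℂ) ⊗ₜ[ℝ] x + Complex.I ⊗ₜ[ℝ] y := by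
  refine ⟨TensorProduct.equivFinsuppOfBasisLeft Complex.basisOneI z 0,
    TensorProduct.equivFinsuppOfBasisLeft Complex.basisOneI z 1, ?_⟩
  conv_lhs => rw [← (TensorProduct.equivFinsuppOfBasisLeft Complex.basisOneI).symm_apply_apply z,
    TensorProduct.equivFinsuppOfBasisLeft_symm_apply, Finsupp.sum_fintype _ _ (by simp)]
  simp

theorem one_tmul_add_I_tmul_eq_iff {V : Type*} [AddCommGroup V] [Module ℝ V] {x y x' y' : V} :
    (1 : ℂ) ⊗ₜ[ℝ] x + Complex.I ⊗ₜ[ℝ] y = (1 : ℂ) ⊗ₜ[ℝ] x' + Complex.I ⊗ₜ[ℝ] y' ↔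
      x = x' ∧ y = y' := by
  refine ⟨fun h => ?_, by rintro ⟨rfl, rfl⟩; rfl⟩
  have key := congrArg (TensorProduct.equivFinsuppOfBasisLeft Complex.basisOneI) h
  have h0 := DFunLike.congr_fun key 0
  have h1 := DFunLike.congr_fun key 1
  simp [Complex.basisOneI] at h0 h1
  exact ⟨h0, h1⟩

/-- The pair `(x, y)` of real and imaginary parts of a root vector for `α`. -/
def IsRootPair (t : Submodule ℝ L) (α : Module.Dual ℝ t) (x y : L) : Prop :=
  ∀ W : t, ⁅(W : L), x⁆ = -(α W • y) ∧ ⁅(W : L), y⁆ = α W • x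

/-- Comparing real and imaginary parts in the eigenvalue equation gives two real equations, so that
later arguments about roots can stay in `L`. -/
theorem mem_complexRootSpace_iff {t : Submodule ℝ L} {α : Module.Dual ℝ t} {x y : L} :
    (1 : ℂ) ⊗ₜ[ℝ] x + Complex.I ⊗ₜ[ℝ] y ∈ complexRootSpace t α ↔ IsRootPair t α x y := by
  simp only [complexRootSpace, Submodule.mem_iInf, Module.End.mem_eigenspace_iff, IsRootPair]
  refine forall_congr' fun W => ?_
  rw [← one_tmul_add_I_tmul_eq_iff]
  have e : (Complex.I * (α W : ℂ)) • ((1 : ℂ) ⊗ₜ[ℝ] x + Complex.I ⊗ₜ[ℝ] y) =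
      (1 : ℂ) ⊗ₜ[ℝ] (-(α W • y)) + Complex.I ⊗ₜ[ℝ] (α W • x) := by
    have h1 : Complex.I * (α W : ℂ) = α W • Complex.I := by simp [mul_comm]
    have h2 : Complex.I * (α W : ℂ) * Complex.I = (-α W) • (1 : ℂ) := by
      rw [mul_right_comm, Complex.I_mul_I]; simp
    rw [smul_add, TensorProduct.smul_tmul', TensorProduct.smul_tmul', smul_eq_mul, smul_eq_mul,
      mul_one, h2, h1, TensorProduct.smul_tmul, TensorProduct.smul_tmul, neg_smul, add_comm]
  rw [e]
  simp [LieAlgebra.ExtendScalars.bracket_tmul]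

theorem mem_realRoots_iff {t : Submodule ℝ L} {α : Module.Dual ℝ t} :
    α ∈ realRoots t ↔ α ≠ 0 ∧ ∃ x y : L, (x ≠ 0 ∨ y ≠ 0) ∧ IsRootPair t α x y := by
  refine and_congr_right fun _ => ?_
  rw [Submodule.ne_bot_iff]
  constructor
  · rintro ⟨z, hz, hz0⟩
    obtain ⟨x, y, rfl⟩ := exists_eq_one_tmul_add_I_tmul z
    refine ⟨x, y, ?_, mem_complexRootSpace_iff.1 hz⟩
    by_contra! h
    simp [h.1, h.2] at hz0
  · rintro ⟨x, y, hxy, h⟩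
    refine ⟨_, mem_complexRootSpace_iff.2 h, fun h0 => ?_⟩
    have := (one_tmul_add_I_tmul_eq_iff (x' := (0 : L)) (y' := (0 : L))).1 (by simpa using h0)
    tauto

/-- Complex conjugation carries a root vector for `α` to one for `-α`. -/
theorem neg_mem_realRoots {t : Submodule ℝ L} {α : Module.Dual ℝ t} (h : α ∈ realRoots t) :
    -α ∈ realRoots t := by
  rw [mem_realRoots_iff] at h ⊢
  obtain ⟨h0, x, y, hxy, h⟩ := h
  exact ⟨neg_ne_zero.2 h0, x, -y, by simpa using hxy, fun W => by simp [(h W).1, (h W).2]⟩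

/-- Composing a root with an automorphism preserving the subspace gives a root. -/
theorem comp_mem_realRoots {t : Submodule ℝ L} {α : Module.Dual ℝ t} (h : α ∈ realRoots t)
    (θ : L →ₗ⁅ℝ⁆ L) (hθ : ∀ X, θ (θ X) = X) (θt : t →ₗ[ℝ] t) (hθt : ∀ W, (θt W : L) = θ W) :
    α.comp θt ∈ realRoots t := by
  have hθt2 : ∀ W, θt (θt W) = W := fun W => Subtype.ext (by simp [hθt, hθ])
  have hinj : ∀ X, θ X = 0 → X = 0 := fun X hX => by rw [← hθ X, hX, map_zero]
  rw [mem_realRoots_iff] at h ⊢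
  obtain ⟨h0, x, y, hxy, h⟩ := h
  refine ⟨fun h1 => h0 ?_, θ x, θ y, hxy.imp (mt (hinj _)) (mt (hinj _)), fun W => ?_⟩
  · ext W
    simpa [hθt2] using DFunLike.congr_fun h1 (θt W)
  · obtain ⟨h1, h2⟩ := h (θt W)
    have e : (W : L) = θ (θt W) := by rw [hθt, hθ]
    constructor
    · rw [e, ← LieHom.map_lie, h1]; simp
    · rw [e, ← LieHom.map_lie, h2]; simp

/-- Since `t` is abelian, the operators `ad W` commute; their joint generalized eigenspaces are
independent, and a finite-dimensional space has room for only finitely many nonzero ones. -/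
theorem finite_realRoots [FiniteDimensional ℝ L] {t : Submodule ℝ L}
    (ht : ∀ X ∈ t, ∀ Y ∈ t, ⁅X, Y⁆ = 0) : (realRoots t).Finite := by
  let f : t → Module.End ℂ (ℂ ⊗[ℝ] L) := fun W =>
    LieAlgebra.ad ℂ (ℂ ⊗[ℝ] L) ((1 : ℂ) ⊗ₜ[ℝ] (W : L))
  have hind := Module.End.independent_iInf_maxGenEigenspace_of_forall_mapsTo f (fun i j φ => by
    refine Module.End.mapsTo_maxGenEigenspace_of_comm ?_ φ
    change f j * f i = f i * f j
    ext z
    have := leibniz_lie ((1 : ℂ) ⊗ₜ[ℝ] (j : L)) ((1 : ℂ) ⊗ₜ[ℝ] (i : L)) ((1 : ℂ) ⊗ₜ[ℝ] z)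
    have h0 : ⁅(1 : ℂ) ⊗ₜ[ℝ] (j : L), (1 : ℂ) ⊗ₜ[ℝ] (i : L)⁆ = 0 := by
      rw [LieAlgebra.ExtendScalars.bracket_tmul, ht _ j.2 _ i.2, TensorProduct.tmul_zero]
    rw [h0, zero_lie, zero_add] at this
    simpa [f] using this)
  have hfin := WellFoundedGT.finite_ne_bot_of_iSupIndep hind
  refine Set.Finite.of_finite_image
    (f := fun (α : Module.Dual ℝ t) (W : t) => Complex.I * (α W : ℂ)) (hfin.subset ?_) ?_
  · rintro _ ⟨α, hα, rfl⟩
    refine fun hbot => hα.2 (eq_bot_iff.2 (le_trans ?_ hbot.le))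
    exact iInf_mono fun W => Module.End.genEigenspace_le_maximal _ _ 1
  · intro α _ β _ h
    ext W
    simpa using congrFun h W

end RealRoots

/-! ### Angles between roots -/

section Obtuse

variable {L : Type*} [LieRing L] [LieAlgebra ℝ L] {t : Submodule ℝ L}
  (B : L →ₗ[ℝ] L →ₗ[ℝ] ℝ)

/-- Invariance of `B` under some `W` with `α W ≠ 0` gives `α W * (B x x - B y y) = 0`. Hence both
parts of a nonzero root vector are nonzero. -/
theorem IsRootPair.norm_eq (hinv : ∀ X Y Z : L, B ⁅X, Y⁆ Z = -B Y ⁅X, Z⁆) {α : Module.Dual ℝ t} (hα : α ≠ 0) {x y : L} (h : IsRootPair t α x y) :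
    B x x = B y y := by
  obtain ⟨W, hW⟩ : ∃ W, α W ≠ 0 := by
    by_contra! h; exact hα (LinearMap.ext h)
  have h1 := hinv W x y
  rw [(h W).1, (h W).2] at h1
  simp at h1
  exact (h1.resolve_right hW).symm

/-- If the difference of two distinct roots is not a root, then the angle between them is not
acute. -/
theorem apply_coroot_nonpos
    (hsymm : ∀ X Y, B X Y = B Y X) (hpos : ∀ X, X ≠ 0 → 0 < B X X)
    (hinv : ∀ X Y Z : L, B ⁅X, Y⁆ Z = -B Y ⁅X, Z⁆)
    (ht : ∀ X : L, (∀ W ∈ t, ⁅W, X⁆ = 0) → X ∈ t) {α β : Module.Dual ℝ t}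
    (hα : α ∈ realRoots t) (hβ : β ∈ realRoots t) (hne : β - α ≠ 0)
    (hsub : β - α ∉ realRoots t) (H : t) (hH : ∀ W : t, B H W = α W) : β H ≤ 0 := by
  rw [mem_realRoots_iff] at hα hβ
  obtain ⟨hα0, x, y, hxy, h⟩ := hα
  obtain ⟨hβ0, u, v, huv, h'⟩ := hβ
  have hnn : ∀ X, 0 ≤ B X X := fun X => by
    by_cases hX : X = 0
    · simp [hX]
    · exact (hpos X hX).le
  have posn : ∀ {γ : Module.Dual ℝ t} {a b : L}, γ ≠ 0 → (a ≠ 0 ∨ b ≠ 0) → IsRootPair t γ a b →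
      0 < B a a := by
    rintro γ a b hγ (ha | hb) hab
    · exact hpos a ha
    · rw [hab.norm_eq B hinv hγ]; exact hpos b hb
  -- These are the real and imaginary parts of the bracket of `x - iy`, a root vector for `-α`, with
  -- `u + iv`. If either were nonzero, `β - α` would be a root.
  have hPQ : ⁅x, u⁆ + ⁅y, v⁆ = 0 ∧ ⁅x, v⁆ - ⁅y, u⁆ = 0 := by
    by_contra hcon
    refine hsub (mem_realRoots_iff.2 ⟨hne, _, _, not_and_or.1 hcon, fun W => ?_⟩)
    have l' : ∀ a b : L, ⁅(W : L), ⁅a, b⁆⁆ = ⁅⁅(W : L), a⁆, b⁆ + ⁅a, ⁅(W : L), b⁆⁆ :=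
      fun a b => leibniz_lie _ _ _
    constructor
    · simp only [lie_add, l', (h W).1, (h W).2, (h' W).1, (h' W).2, neg_lie, smul_lie, lie_neg,
        lie_smul, LinearMap.sub_apply]
      module
    · simp only [lie_sub, l', (h W).1, (h W).2, (h' W).1, (h' W).2, neg_lie, smul_lie, lie_neg,
        lie_smul, LinearMap.sub_apply]
      module
  have hmem : ⁅x, y⁆ ∈ t := ht _ fun W hW => by
    rw [leibniz_lie, (h ⟨W, hW⟩).1, (h ⟨W, hW⟩).2]
    simp
  -- Up to a negative factor, `⁅x, y⁆` is the vector dual to `α`; the sign of `β` on it is therefore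
  -- what has to be found.
  have hxyH : (⟨⁅x, y⁆, hmem⟩ : t) = -(B x x) • H := by
    have : ∀ W : t, B ⁅x, y⁆ W = -(B x x) * α W := fun W => by
      rw [hsymm, ← neg_neg (B W ⁅x, y⁆), ← lie_skew x y, map_neg, neg_neg]
      have e := hinv y x W
      rw [← lie_skew y (W : L), (h W).2] at e
      rw [hsymm, e]; simp [mul_comm]
    have hz : ∀ Z : t, (∀ W : t, B Z W = 0) → Z = 0 := fun Z hZ => by
      by_contra hZ0
      exact (hpos Z (by simpa using hZ0)).ne' (hZ Z)
    rw [← sub_eq_zero]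
    refine hz _ fun W => ?_
    simp [this, hH]
  -- By the Jacobi identity, `hPQ` and invariance, this product equals `|⁅x, u⁆|² + |⁅x, v⁆|²`.
  have key : 0 ≤ β ⟨⁅x, y⁆, hmem⟩ * B u u := by
    obtain ⟨hP, hQ⟩ := hPQ
    have e1 : ⁅y, v⁆ = -⁅x, u⁆ := by rw [eq_neg_iff_add_eq_zero, add_comm]; exact hP
    have e2 : ⁅y, u⁆ = ⁅x, v⁆ := (sub_eq_zero.1 hQ).symm
    have e3 := (h' ⟨⁅x, y⁆, hmem⟩).2
    simp only [lie_lie, e1] at e3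
    have e4 : B u (⁅x, -⁅x, u⁆⁆ - ⁅y, ⁅x, v⁆⁆) = B ⁅x, u⁆ ⁅x, u⁆ + B ⁅x, v⁆ ⁅x, v⁆ := by
      have a1 := hinv x u ⁅x, u⁆
      have a2 := hinv y u ⁅x, v⁆
      rw [e2] at a2
      rw [lie_neg, map_sub, map_neg, a1, a2]; ring
    rw [e3, map_smul, smul_eq_mul] at e4
    rw [e4]
    exact add_nonneg (hnn _) (hnn _)
  rw [hxyH, map_smul, smul_eq_mul] at key
  have hx := posn hα0 hxy h
  have hu := posn hβ0 huv h'
  by_contra! hlt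
  have : 0 < B x x * β H * B u u := by positivity
  linarith

end Obtuse

/-! ### Chambers as sign conditions -/

section ChamberLemmas

variable {V : Type*} [AddCommGroup V] [Module ℝ V]

theorem mem_regularSet_iff {Φ : Set (Module.Dual ℝ V)} {x : V} :
    x ∈ regularSet Φ ↔ ∀ α ∈ Φ, α x ≠ 0 := by
  simp [regularSet]

/-- If every simple root takes the value `1` at a point then every positive root takes a value
`≥ 1` there. -/
theorem one_le_apply_of_mem_positiveRoots {Φ : Set (Module.Dual ℝ V)} (hΦ : Φ.Finite) {C : Set V}
    (hC : C.Nonempty) {x : V} (hx : ∀ b ∈ simpleRoots Φ C, b x = 1) :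
    ∀ α ∈ positiveRoots Φ C, 1 ≤ α x := by
  obtain ⟨x₀, hx₀⟩ := hC
  by_contra! hcon
  -- Take a counterexample with the smallest value at a point `x₀` of `C`. It is not simple, and
  -- both summands have smaller values at `x₀`, so they are no counterexamples.
  obtain ⟨α, ⟨hα, hlt⟩, hmin⟩ := Set.exists_min_image {α | α ∈ positiveRoots Φ C ∧ α x < 1}
    (fun α => α x₀) (hΦ.subset fun α h => h.1.1) hcon
  have hns : ∃ β ∈ positiveRoots Φ C, ∃ γ ∈ positiveRoots Φ C, α = β + γ := by
    by_contra h
    exact hlt.ne (hx α ⟨hα, h⟩)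
  obtain ⟨β, hβ, γ, hγ, rfl⟩ := hns
  have key : ∀ δ ∈ positiveRoots Φ C, δ x₀ < (β + γ) x₀ → 1 ≤ δ x := fun δ hδ hlt' => by
    by_contra! h
    exact (hmin δ ⟨hδ, h⟩).not_gt hlt'
  have h1 := key β hβ (by simpa using hγ.2 x₀ hx₀)
  have h2 := key γ hγ (by simpa using hβ.2 x₀ hx₀)
  simp only [LinearMap.add_apply] at hlt
  linarith

variable [TopologicalSpace V] [IsTopologicalAddGroup V] [ContinuousSMul ℝ V] [T2Space V]
  [FiniteDimensional ℝ V]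

/-- The connected component of `x` in the complement of the hyperplanes is the set of points at
which every form has the same sign as at `x`. -/
theorem mem_connectedComponentIn_regularSet_iff {Φ : Set (Module.Dual ℝ V)} {x y : V}
    (hx : x ∈ regularSet Φ) :
    y ∈ connectedComponentIn (regularSet Φ) x ↔ ∀ α ∈ Φ, 0 < α x * α y := by
  constructor
  · intro hy α hα
    have hc : IsPreconnected (α '' connectedComponentIn (regularSet Φ) x) :=
      isPreconnected_connectedComponentIn.image _ (LinearMap.continuous_of_finiteDimensional α
        ).continuousOn
    have h0 : (0 : ℝ) ∉ α '' connectedComponentIn (regularSet Φ) x := by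
      rintro ⟨z, hz, hz0⟩
      exact mem_regularSet_iff.1 (connectedComponentIn_subset _ _ hz) α hα hz0
    have hsub := hc.ordConnected
    have hxm : α x ∈ α '' connectedComponentIn (regularSet Φ) x :=
      ⟨x, mem_connectedComponentIn hx, rfl⟩
    have hym : α y ∈ α '' connectedComponentIn (regularSet Φ) x := ⟨y, hy, rfl⟩
    have hx0 := mem_regularSet_iff.1 hx α hα
    by_contra! hle
    rcases lt_or_gt_of_ne hx0 with h | h
    · exact h0 (hsub.out hxm hym ⟨h.le, by nlinarith⟩)
    · exact h0 (hsub.out hym hxm ⟨by nlinarith, h.le⟩)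
  · intro hy
    have hconv : Convex ℝ {z | ∀ α ∈ Φ, 0 < α x * α z} := by
      intro a ha b hb r s hr hs hrs α hα
      have h1 := ha α hα
      have h2 := hb α hα
      have : α x * α (r • a + s • b) = r * (α x * α a) + s * (α x * α b) := by
        simp; ring
      rw [this]
      rcases hr.eq_or_lt with rfl | hr
      · have : s = 1 := by linarith
        simpa [this] using h2
      · have := mul_pos hr h1
        have := mul_nonneg hs h2.le
        linarith
    refine hconv.isPreconnected.subset_connectedComponentIn (fun α hα => ?_) ?_ hy
    · exact mul_self_pos.2 (mem_regularSet_iff.1 hx α hα)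
    · exact fun z hz => mem_regularSet_iff.2 fun α hα h0 => by simpa [h0] using hz α hα

theorem mem_weylChamber_iff {Φ : Set (Module.Dual ℝ V)} {C : Set V} (hC : C ∈ weylChambers Φ)
    {x y : V} (hx : x ∈ C) : y ∈ C ↔ ∀ α ∈ Φ, 0 < α x * α y := by
  obtain ⟨z, hz, rfl⟩ := hC
  rw [connectedComponentIn_eq hx,
    mem_connectedComponentIn_regularSet_iff (connectedComponentIn_subset _ _ hx)]

theorem mem_positiveRoots_iff {Φ : Set (Module.Dual ℝ V)} {C : Set V} (hC : C ∈ weylChambers Φ)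
    {x : V} (hx : x ∈ C) {α : Module.Dual ℝ V} : α ∈ positiveRoots Φ C ↔ α ∈ Φ ∧ 0 < α x := by
  refine and_congr_right fun hα => ⟨fun h => h x hx, fun h y hy => ?_⟩
  exact pos_of_mul_pos_right ((mem_weylChamber_iff hC hx).1 hy α hα) h.le

end ChamberLemmas

/-! ### Restriction of forms to a subspace -/

section Restriction

variable {L : Type*} [AddCommGroup L] [Module ℝ L] {s t : Submodule ℝ L} (h : s ≤ t)
  (Φ : Set (Module.Dual ℝ t))

theorem mem_regularSet_restrictForm_iff {x : s} :
    x ∈ regularSet (restrictForm h '' Φ) ↔ Submodule.inclusion h x ∈ regularSet Φ := by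
  simp [mem_regularSet_iff, restrictForm]

variable [TopologicalSpace L] [IsTopologicalAddGroup L] [ContinuousSMul ℝ L] [T2Space L]
  [FiniteDimensional ℝ L]

theorem connectedComponentIn_regularSet_restrictForm {x : s}
    (hx : Submodule.inclusion h x ∈ regularSet Φ) :
    connectedComponentIn (regularSet (restrictForm h '' Φ)) x =
      interSubspace h (connectedComponentIn (regularSet Φ) (Submodule.inclusion h x)) := by
  ext y
  rw [mem_connectedComponentIn_regularSet_iff ((mem_regularSet_restrictForm_iff h Φ).2 hx),
    interSubspace, Set.mem_preimage, mem_connectedComponentIn_regularSet_iff hx]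
  simp [restrictForm]

/-- Both sides are described by the same sign conditions, so this holds for an arbitrary set of
forms and uses no Lie theory. -/
theorem weylChambers_restrictForm_eq_compartments :
    weylChambers (restrictForm h '' Φ) = compartments h Φ := by
  ext D
  constructor
  · rintro ⟨x, hx, rfl⟩
    refine ⟨⟨x, mem_connectedComponentIn hx⟩, ?_⟩
    rw [mem_regularSet_restrictForm_iff] at hx
    exact ⟨_, ⟨_, hx, rfl⟩, connectedComponentIn_regularSet_restrictForm h Φ hx⟩
  · rintro ⟨⟨x, hx⟩, C, ⟨z, hz, rfl⟩, rfl⟩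
    have hx' : Submodule.inclusion h x ∈ regularSet Φ := connectedComponentIn_subset _ _ hx
    refine ⟨x, (mem_regularSet_restrictForm_iff h Φ).2 hx', ?_⟩
    rw [connectedComponentIn_regularSet_restrictForm h Φ hx', ← connectedComponentIn_eq hx]

theorem positiveRoots_restrictForm {C : Set t} (hC : C ∈ weylChambers Φ)
    (hne : (interSubspace h C).Nonempty) :
    positiveRoots (restrictForm h '' Φ) (interSubspace h C) =
      restrictForm h '' positiveRoots Φ C := by
  obtain ⟨x, hx⟩ := hne
  have hD : interSubspace h C ∈ weylChambers (restrictForm h '' Φ) := by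
    rw [weylChambers_restrictForm_eq_compartments]
    exact ⟨⟨x, hx⟩, C, hC, rfl⟩
  ext α
  rw [mem_positiveRoots_iff hD hx]
  constructor
  · rintro ⟨⟨α, hα, rfl⟩, hpos⟩
    exact ⟨α, (mem_positiveRoots_iff hC hx).2 ⟨hα, hpos⟩, rfl⟩
  · rintro ⟨α, hα, rfl⟩
    have := (mem_positiveRoots_iff hC hx).1 hα
    exact ⟨⟨α, this.1, rfl⟩, this.2⟩

/-- If there is a point of the subspace at which all simple roots take the value `1`, then
the restrictions of the simple roots are the simple roots of the restricted system. -/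
theorem restrictForm_image_simpleRoots (hΦ : Φ.Finite) {C : Set t} (hC : C ∈ weylChambers Φ)
    (hne : (interSubspace h C).Nonempty) (x : s)
    (hx : ∀ b ∈ simpleRoots Φ C, b (Submodule.inclusion h x) = 1) :
    restrictForm h '' simpleRoots Φ C =
      simpleRoots (restrictForm h '' Φ) (interSubspace h C) := by
  have hCne : C.Nonempty := hne.imp' _ fun _ hy => hy
  have hone := one_le_apply_of_mem_positiveRoots hΦ hCne hx
  ext α
  rw [simpleRoots, simpleRoots, positiveRoots_restrictForm h Φ hC hne]
  constructor
  · rintro ⟨α, hα, rfl⟩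
    refine ⟨⟨α, hα.1, rfl⟩, ?_⟩
    -- The decomposition holds only on `s`, so simplicity of `α` does not refute it directly.
    -- Evaluation at `x` does: the left side is 1, the right side at least 2.
    rintro ⟨_, ⟨β, hβ, rfl⟩, _, ⟨γ, hγ, rfl⟩, e⟩
    have e' : α (Submodule.inclusion h x) = β (Submodule.inclusion h x) +
      γ (Submodule.inclusion h x) := DFunLike.congr_fun e x
    rw [hx α hα] at e'
    linarith [hone β hβ, hone γ hγ]
  · rintro ⟨⟨α, hα, rfl⟩, hns⟩
    refine ⟨α, ⟨hα, ?_⟩, rfl⟩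
    rintro ⟨β, hβ, γ, hγ, rfl⟩
    exact hns ⟨_, ⟨β, hβ, rfl⟩, _, ⟨γ, hγ, rfl⟩, rfl⟩

end Restriction

/-! ### Linear independence of the simple roots -/

section SimpleRoots

variable {L : Type*} [LieRing L] [LieAlgebra ℝ L] [FiniteDimensional ℝ L]

theorem exists_forall_apply_eq {V : Type*} [AddCommGroup V] [Module ℝ V] [FiniteDimensional ℝ V]
    (B : V →ₗ[ℝ] V →ₗ[ℝ] ℝ) (hpos : ∀ X, X ≠ 0 → 0 < B X X) (f : Module.Dual ℝ V) :
    ∃ H : V, ∀ W, B H W = f W := by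
  have hinj : Function.Injective B := by
    rw [injective_iff_map_eq_zero]
    intro X hX
    by_contra h0
    simpa [hX] using hpos X h0
  obtain ⟨H, hH⟩ := (LinearMap.injective_iff_surjective_of_finrank_eq_finrank
    (Subspace.dual_finrank_eq).symm).1 hinj f
  exact ⟨H, fun W => by rw [hH]⟩

/-- The simple roots are linearly independent; in particular they can be given the value `1`
simultaneously. -/
theorem exists_forall_simpleRoots_apply_eq_one
    [TopologicalSpace L] [IsTopologicalAddGroup L] [ContinuousSMul ℝ L] [T2Space L]
    {t : Submodule ℝ L} (B : L →ₗ[ℝ] L →ₗ[ℝ] ℝ)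
    (hsymm : ∀ X Y, B X Y = B Y X) (hpos : ∀ X, X ≠ 0 → 0 < B X X)
    (hinv : ∀ X Y Z : L, B ⁅X, Y⁆ Z = -B Y ⁅X, Z⁆)
    (ht : ∀ X : L, (∀ W ∈ t, ⁅W, X⁆ = 0) → X ∈ t)
    {C : Set t} (hC : C ∈ weylChambers (realRoots t)) :
    ∃ x : t, ∀ b ∈ simpleRoots (realRoots t) C, b x = 1 := by
  obtain ⟨x₀, hx₀⟩ : C.Nonempty := by
    obtain ⟨z, hz, rfl⟩ := hC
    exact ⟨z, mem_connectedComponentIn hz⟩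
  let Bt : t →ₗ[ℝ] t →ₗ[ℝ] ℝ := B.domRestrict₁₂ t t
  have hBt : ∀ X Y : t, Bt X Y = B X Y := fun X Y => rfl
  have hpost : ∀ X, X ≠ 0 → 0 < Bt X X := fun X hX => hpos _ (by simpa using hX)
  choose H hH using exists_forall_apply_eq Bt hpost
  have hreg := mem_regularSet_iff.1 (show x₀ ∈ regularSet (realRoots t) by
    obtain ⟨z, hz, rfl⟩ := hC
    exact connectedComponentIn_subset _ _ hx₀)
  -- If `c - b` were a root, it or its negative would be positive, and then `c` or `b` would be a
  -- sum of two positive roots.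
  have hobt : ∀ b ∈ simpleRoots (realRoots t) C, ∀ c ∈ simpleRoots (realRoots t) C, b ≠ c →
      Bt (H b) (H c) ≤ 0 := by
    intro b hb c hc hbc
    have hbH : Bt (H b) (H c) = c (H b) := by
      rw [hBt, hsymm, ← hBt, hH]
    rw [hbH]
    refine apply_coroot_nonpos B hsymm hpos hinv ht hb.1.1 hc.1.1 (sub_ne_zero.2 hbc.symm)
      (fun hmem => ?_) (H b) (fun W => hH b W)
    rcases lt_or_gt_of_ne (hreg _ hmem) with hlt | hgt
    · refine hb.2 ⟨c, hc.1, b - c, (mem_positiveRoots_iff hC hx₀).2 ⟨?_, ?_⟩, by abel⟩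
      · simpa using neg_mem_realRoots hmem
      · simp only [LinearMap.sub_apply] at hlt ⊢; linarith
    · exact hc.2 ⟨b, hb.1, c - b, (mem_positiveRoots_iff hC hx₀).2 ⟨hmem, hgt⟩, by abel⟩
  have hli : LinearIndependent ℝ fun b : simpleRoots (realRoots t) C => H b := by
    refine LinearMap.BilinForm.linearIndependent_of_pairwise_le_zero Bt ?_ (Bt x₀) _ ?_ ?_
    · intro X hX
      exact hpost X hX
    · intro b
      rw [hBt, hsymm, ← hBt, hH]
      exact b.2.1.2 x₀ hx₀
    · intro b c hbc
      exact hobt b b.2 c c.2 (fun h => hbc (Subtype.ext h))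
  -- By independence some functional takes the value 1 on every `H b`; the vector representing it
  -- with respect to `Bt` is the required point.
  obtain ⟨f, hf⟩ := LinearMap.exists_extend
    ((Finsupp.linearCombination ℝ fun _ : simpleRoots (realRoots t) C => (1 : ℝ)) ∘ₗ
      (hli.repr : _ →ₗ[ℝ] _))
  refine ⟨H f, fun b hb => ?_⟩
  rw [← hH b, hBt, hsymm, ← hBt, hH]
  have hb' : H b ∈ Submodule.span ℝ
      (Set.range fun b : simpleRoots (realRoots t) C => H b) :=
    Submodule.subset_span ⟨⟨b, hb⟩, rfl⟩
  have := DFunLike.congr_fun hf ⟨H b, hb'⟩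
  simp only [LinearMap.comp_apply, Submodule.subtype_apply] at this
  rw [this]
  erw [hli.repr_eq_single ⟨b, hb⟩ ⟨H b, hb'⟩ rfl]
  simp

end SimpleRoots

/-! ### The theorem for Lie algebras with involution -/

section Involution

variable {L : Type*} [LieRing L] [LieAlgebra ℝ L]

/-- Let `s` be maximal abelian in the fixed points of an involution. Then the centralizer of `s`
is abelian, so that it is the maximal abelian subspace `t ⊇ s`. -/
theorem mem_of_forall_lie_eq_zero_of_involution {s t : Submodule ℝ L} (hst : s ≤ t)
    (B : L →ₗ[ℝ] L →ₗ[ℝ] ℝ) (hpos : ∀ X, X ≠ 0 → 0 < B X X)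
    (hinv : ∀ X Y Z : L, B ⁅X, Y⁆ Z = -B Y ⁅X, Z⁆)
    (ht : ∀ X : L, X ∈ t ↔ ∀ W ∈ t, ⁅W, X⁆ = 0)
    (θ : L →ₗ⁅ℝ⁆ L) (hθ : ∀ X, θ (θ X) = X)
    (hs : ∀ X : L, X ∈ s ↔ θ X = X ∧ ∀ W ∈ s, ⁅W, X⁆ = 0)
    {X : L} (hX : ∀ W ∈ s, ⁅W, X⁆ = 0) : X ∈ t := by
  have hθc : ∀ Y : L, (∀ W ∈ s, ⁅W, Y⁆ = 0) → ∀ W ∈ s, ⁅W, θ Y⁆ = 0 := fun Y hY W hW => by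
    rw [← ((hs W).1 hW).1, ← LieHom.map_lie, hY W hW, map_zero]
  have hlie : ∀ Y Z : L, (∀ W ∈ s, ⁅W, Y⁆ = 0) → (∀ W ∈ s, ⁅W, Z⁆ = 0) →
      ∀ W ∈ s, ⁅W, ⁅Y, Z⁆⁆ = 0 := fun Y Z hY hZ W hW => by
    rw [leibniz_lie, hY W hW, hZ W hW]; simp
  -- For two `-1` eigenvectors centralizing `s`, the bracket is fixed by `θ` and centralizes `s`,
  -- hence lies in `s` and commutes with `Y`. By invariance its norm squared is `-B Z ⁅Y, ⁅Y, Z⁆⁆ =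
  -- 0`.
  have hp : ∀ Y Z : L, (∀ W ∈ s, ⁅W, Y⁆ = 0) → (∀ W ∈ s, ⁅W, Z⁆ = 0) → θ Y = -Y → θ Z = -Z →
      ⁅Y, Z⁆ = 0 := by
    intro Y Z hY hZ hY' hZ'
    have hm : ⁅Y, Z⁆ ∈ s := (hs _).2 ⟨by rw [LieHom.map_lie, hY', hZ']; simp, hlie Y Z hY hZ⟩
    by_contra h0
    have := hpos _ h0
    rw [hinv, ← lie_skew Y ⁅Y, Z⁆, hY _ hm] at this
    simp at this
  -- Split `Y` into its two `θ`-eigenparts. The `+1` part lies in `s` by maximality.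
  have hdec : ∀ Y : L, (∀ W ∈ s, ⁅W, Y⁆ = 0) → ∃ U V : L, U ∈ s ∧ (∀ W ∈ s, ⁅W, V⁆ = 0) ∧
      θ V = -V ∧ Y = U + V := by
    intro Y hY
    refine ⟨(1 / 2 : ℝ) • (Y + θ Y), (1 / 2 : ℝ) • (Y - θ Y), (hs _).2 ⟨?_, ?_⟩, ?_, ?_, ?_⟩
    · simp [hθ, add_comm]
    · intro W hW; simp [hY W hW, hθc Y hY W hW]
    · intro W hW; simp [hY W hW, hθc Y hY W hW]
    · simp [hθ, smul_sub]
    · module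
  rw [ht]
  intro W hW
  obtain ⟨U, V, hU, hV, hV', rfl⟩ := hdec X hX
  obtain ⟨U', V', hU', hV'c, hV'', rfl⟩ := hdec W fun W' hW' => (ht W).1 hW W' (hst hW')
  have h1 : ⁅U', U⁆ = 0 := ((hs U).1 hU).2 _ hU'
  have h2 : ⁅V', U⁆ = 0 := by rw [← lie_skew, hV'c U hU, neg_zero]
  simp [h1, h2, hV U' hU', hp V' V hV'c hV hV'' hV']

variable [FiniteDimensional ℝ L]
  [TopologicalSpace L] [IsTopologicalAddGroup L] [ContinuousSMul ℝ L] [T2Space L]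

/-- The infinitesimal form of the theorem: `s` is maximal abelian in the fixed points of an
involution of a Lie algebra with invariant inner product, and `t ⊇ s` is maximal abelian. -/
theorem restrictForm_image_simpleRoots_of_involution {s t : Submodule ℝ L} (hst : s ≤ t)
    (B : L →ₗ[ℝ] L →ₗ[ℝ] ℝ) (hsymm : ∀ X Y, B X Y = B Y X) (hpos : ∀ X, X ≠ 0 → 0 < B X X)
    (hinv : ∀ X Y Z : L, B ⁅X, Y⁆ Z = -B Y ⁅X, Z⁆)
    (ht : ∀ X : L, X ∈ t ↔ ∀ W ∈ t, ⁅W, X⁆ = 0)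
    (θ : L →ₗ⁅ℝ⁆ L) (hθ : ∀ X, θ (θ X) = X)
    (hs : ∀ X : L, X ∈ s ↔ θ X = X ∧ ∀ W ∈ s, ⁅W, X⁆ = 0)
    {C : Set t} (hC : C ∈ weylChambers (realRoots t)) (hne : (interSubspace hst C).Nonempty) :
    restrictForm hst '' simpleRoots (realRoots t) C =
      simpleRoots (restrictForm hst '' realRoots t) (interSubspace hst C) := by
  have hcent : ∀ X, (∀ W ∈ s, ⁅W, X⁆ = 0) → X ∈ t := fun X =>
    mem_of_forall_lie_eq_zero_of_involution hst B hpos hinv ht θ hθ hs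
  have hfix : ∀ W ∈ s, θ W = W := fun W hW => ((hs W).1 hW).1
  have hθt : ∀ X ∈ t, θ X ∈ t := fun X hX => hcent _ fun W hW => by
    rw [← hfix W hW, ← LieHom.map_lie, (ht X).1 hX W (hst hW), map_zero]
  let θt : t →ₗ[ℝ] t := (θ : L →ₗ[ℝ] L).restrict hθt
  have hθt' : ∀ W, (θt W : L) = θ W := fun W => rfl
  have hθt2 : ∀ W, θt (θt W) = W := fun W => Subtype.ext (by simp [hθt', hθ])
  obtain ⟨x₀, hx₀⟩ := id hne
  have hfix' : ∀ W : s, θt (Submodule.inclusion hst W) = Submodule.inclusion hst W := fun W =>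
    Subtype.ext (by rw [hθt']; exact hfix _ W.2)
  -- Positivity can be tested at the single point `x₀` of `C ∩ s`, which `θ` fixes.
  have hposθ : ∀ α ∈ positiveRoots (realRoots t) C, α.comp θt ∈ positiveRoots (realRoots t) C :=
    fun α hα => by
      rw [mem_positiveRoots_iff hC hx₀] at hα ⊢
      refine ⟨comp_mem_realRoots hα.1 θ hθ θt hθt', ?_⟩
      rw [LinearMap.comp_apply, hfix']
      exact hα.2
  have hinvol : ∀ α : Module.Dual ℝ t, (α.comp θt).comp θt = α := fun α =>
    LinearMap.ext fun W => by simp [hθt2]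
  have hsimpleθ : ∀ α ∈ simpleRoots (realRoots t) C, α.comp θt ∈ simpleRoots (realRoots t) C := by
    rintro α ⟨hα, hns⟩
    refine ⟨hposθ α hα, ?_⟩
    rintro ⟨β, hβ, γ, hγ, e⟩
    refine hns ⟨_, hposθ β hβ, _, hposθ γ hγ, ?_⟩
    rw [← LinearMap.add_comp, ← e, hinvol]
  obtain ⟨x, hx⟩ := exists_forall_simpleRoots_apply_eq_one B hsymm hpos hinv
    (fun X => (ht X).2) hC
  -- Averaging over `θ` moves `x` into `s`; since `θ` permutes the simple roots, they all keep the
  -- value 1.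
  have hxs : (((1 / 2 : ℝ) • (x + θt x) : t) : L) ∈ s := by
    refine (hs _).2 ⟨?_, fun W hW => (ht _).1 (Subtype.prop _) W (hst hW)⟩
    simp [hθt', hθ, add_comm]
  refine restrictForm_image_simpleRoots hst _
    (finite_realRoots fun X hX Y hY => (ht Y).1 hY X hX) hC hne ⟨_, hxs⟩ fun b hb => ?_
  have h1 := hx b hb
  have h2 := hx _ (hsimpleθ b hb)
  rw [LinearMap.comp_apply] at h2
  change b ((1 / 2 : ℝ) • (x + θt x)) = 1
  rw [map_smul, map_add, h1, h2]
  norm_num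

end Involution

/-! ### Compact commutative groups of linear operators -/

section OneParameter

open NormedSpace Filter Topology

variable {A : Type*} [NormedRing A] [NormedAlgebra ℝ A] [CompleteSpace A]

/-- The powers of `exp (b n)` with exponent `⌊s / ‖b n‖⌋₊` stay in `S` and converge to `exp (s •
u)`: the floor changes the length by at most `‖b n‖`, which tends to 0. -/
theorem exp_smul_mem_of_tendsto {S : Set A} (hS : IsClosed S) (hpow : ∀ a ∈ S, ∀ k : ℕ, a ^ k ∈ S)
    {b : ℕ → A} (hb : ∀ n, b n ≠ 0) (hb0 : Tendsto b atTop (𝓝 0)) (hbS : ∀ n, exp (b n) ∈ S)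
    {u : A} (hu : Tendsto (fun n => ‖b n‖⁻¹ • b n) atTop (𝓝 u)) {s : ℝ} (hs : 0 ≤ s) :
    exp (s • u) ∈ S := by
  let _ : NormedAlgebra ℚ A := NormedAlgebra.restrictScalars ℚ ℝ A
  have hn0 : Tendsto (fun n => ‖b n‖) atTop (𝓝 0) := by simpa using hb0.norm
  have hk : Tendsto (fun n => (⌊s / ‖b n‖⌋₊ : ℝ) * ‖b n‖) atTop (𝓝 s) := by
    refine tendsto_of_tendsto_of_tendsto_of_le_of_le (g := fun n => s - ‖b n‖) (h := fun _ => s)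
      (by simpa using hn0.const_sub s) tendsto_const_nhds (fun n => ?_) (fun n => ?_)
    · have hp := norm_pos_iff.2 (hb n)
      have := (Nat.lt_floor_add_one (s / ‖b n‖)).le
      rw [div_le_iff₀ hp] at this
      dsimp only
      linarith
    · have hp := norm_pos_iff.2 (hb n)
      have := Nat.floor_le (div_nonneg hs hp.le)
      rwa [le_div_iff₀ hp] at this
  have h2 := hk.smul hu
  have h3 := ((exp_continuous (𝔸 := A)).tendsto _).comp h2
  refine hS.mem_of_tendsto h3 (Eventually.of_forall fun n => ?_)
  have : (((⌊s / ‖b n‖⌋₊ : ℝ) * ‖b n‖) • ‖b n‖⁻¹ • b n) = ⌊s / ‖b n‖⌋₊ • b n := by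
    rw [smul_smul, mul_assoc, mul_inv_cancel₀ (norm_ne_zero_iff.2 (hb n)), mul_one,
      Nat.cast_smul_eq_nsmul]
  rw [Function.comp_apply, this, exp_nsmul]
  exact hpow _ (hbS n) _

theorem commute_of_forall_commute_exp_smul {D a : A} (h : ∀ s : ℝ, Commute (exp (s • D)) a) :
    Commute D a := by
  have h1 : HasDerivAt (fun s : ℝ => exp (s • D) * a) (D * a) 0 := by
    simpa using (hasDerivAt_exp_smul_const (𝕂 := ℝ) D (0 : ℝ)).mul_const a
  have h2 : HasDerivAt (fun s : ℝ => a * exp (s • D)) (a * D) 0 := by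
    simpa using (hasDerivAt_exp_smul_const (𝕂 := ℝ) D (0 : ℝ)).const_mul a
  exact h1.unique (h2.congr_of_eventuallyEq (Eventually.of_forall fun s => (h s).eq))

/-- The exponential is a local homeomorphism at `0`. -/
theorem exists_exp_local_inverse :
    ∃ l : A → A, ContinuousAt l 1 ∧ l 1 = 0 ∧ (∀ᶠ a in 𝓝 (1 : A), exp (l a) = a) ∧
      ∀ᶠ x in 𝓝 (0 : A), l (exp x) = x := by
  have h : HasStrictFDerivAt (exp : A → A) 
      ((ContinuousLinearEquiv.refl ℝ A : A ≃L[ℝ] A) : A →L[ℝ] A) 0 :=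
    hasStrictFDerivAt_exp_zero (𝕂 := ℝ)
  have he : exp (0 : A) = 1 := exp_zero
  refine ⟨h.localInverse exp _ _, ?_, ?_, ?_, ?_⟩
  · have := h.localInverse_continuousAt; rwa [he] at this
  · have := h.localInverse_apply_image; rwa [he] at this
  · have := h.eventually_right_inverse; rwa [he] at this
  · exact h.eventually_left_inverse

variable [FiniteDimensional ℝ A] {T : Type*} [Group T] [TopologicalSpace T]

/-- The generators of the one-parameter subgroups in a commutative group of invertible elements. -/
def oneParameterGenerators (ρ : T →* A) (hcomm : ∀ g h : T, g * h = h * g) : Submodule ℝ A where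
  carrier := {D | ∀ s : ℝ, exp (s • D) ∈ Set.range ρ}
  zero_mem' := fun s => ⟨1, by simp⟩
  add_mem' := by
    let _ : NormedAlgebra ℚ A := NormedAlgebra.restrictScalars ℚ ℝ A
    intro D D' hD hD' s
    have hc : ∀ s s' : ℝ, Commute (exp (s • D)) (exp (s' • D')) := fun s s' => by
      obtain ⟨g, hg⟩ := hD s
      obtain ⟨h, hh⟩ := hD' s'
      rw [← hg, ← hh]
      change ρ g * ρ h = ρ h * ρ g
      rw [← map_mul, hcomm, map_mul]
    have hDD : Commute D D' := commute_of_forall_commute_exp_smul fun s =>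
      (commute_of_forall_commute_exp_smul fun s' => (hc s s').symm).symm
    obtain ⟨g, hg⟩ := hD s
    obtain ⟨h, hh⟩ := hD' s
    refine ⟨g * h, ?_⟩
    rw [map_mul, hg, hh, smul_add, exp_add_of_commute ((hDD.smul_left s).smul_right s)]
  smul_mem' := by
    intro c D hD s
    rw [smul_smul]
    exact hD _

/-- Near the identity, a compact commutative group is the exponential of its Lie algebra. -/
theorem eventually_exists_eq_exp [CompactSpace T] [IsTopologicalGroup T] (ρ : T →* A)
    (hρ : Continuous ρ) (hcomm : ∀ g h : T, g * h = h * g) :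
    ∀ᶠ g in 𝓝 (1 : T), ∃ D ∈ oneParameterGenerators ρ hcomm, ρ g = exp D := by
  let _ : NormedAlgebra ℚ A := NormedAlgebra.restrictScalars ℚ ℝ A
  set 𝔰 := oneParameterGenerators ρ hcomm with h𝔰
  obtain ⟨l, hlc, hl1, hexpl, hlexp⟩ := exists_exp_local_inverse (A := A)
  have hρ1 : Tendsto ρ (𝓝 1) (𝓝 1) := by simpa using hρ.tendsto 1
  have hlρ : Tendsto (fun g => l (ρ g)) (𝓝 1) (𝓝 0) := by
    have := hlc.tendsto.comp hρ1
    rwa [hl1] at this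
  have hρi : ∀ h : T, ρ h * ρ h⁻¹ = 1 := fun h => by rw [← map_mul]; simp
  have hρi' : ∀ h : T, ρ h⁻¹ * ρ h = 1 := fun h => by rw [← map_mul]; simp
  -- Conjugation by `ρ h` fixes `ρ g`, hence fixes its logarithm as long as the conjugated logarithm
  -- stays where `l` inverts `exp`. Compactness of `T` makes the neighbourhood uniform in `h`.
  have hcommL : ∀ᶠ g in 𝓝 (1 : T), ∀ h : T, Commute (ρ h) (l (ρ g)) := by
    have hconj : Continuous fun p : A × T => ρ p.2 * p.1 * ρ p.2⁻¹ := by fun_prop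
    have h1 : ∀ᶠ x in 𝓝 (0 : A), ∀ h ∈ (Set.univ : Set T),
        l (exp (ρ h * x * ρ h⁻¹)) = ρ h * x * ρ h⁻¹ := by
      refine isCompact_univ.eventually_forall_of_forall_eventually fun h _ => ?_
      have := hconj.tendsto (0, h)
      rw [mul_zero, zero_mul] at this
      exact this.eventually hlexp
    filter_upwards [hlρ.eventually h1, hρ1.eventually hexpl] with g hg1 hg3 h
    have h2 := hg1 h trivial
    have h3 : exp (ρ h * l (ρ g) * ρ h⁻¹) = ρ g := by
      have := exp_units_conj (⟨ρ h, ρ h⁻¹, hρi h, hρi' h⟩ : Aˣ) (l (ρ g))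
      change exp (ρ h * l (ρ g) * ρ h⁻¹) = ρ h * exp (l (ρ g)) * ρ h⁻¹ at this
      rw [this, hg3, ← map_mul, ← map_mul, hcomm h g]
      simp
    rw [h3] at h2
    calc ρ h * l (ρ g) = ρ h * l (ρ g) * ρ h⁻¹ * ρ h := by rw [mul_assoc _ _ (ρ h), hρi', mul_one]
      _ = l (ρ g) * ρ h := by rw [← h2]
  obtain ⟨W, hW⟩ := 𝔰.exists_isCompl
  let p : A →ₗ[ℝ] A := W.projection 𝔰 hW.symm
  have hpW : ∀ x, p x ∈ W := fun x => Submodule.projection_apply_mem hW.symm x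
  have hps : ∀ x, x - p x ∈ 𝔰 := fun x => by
    have := Submodule.projection_add_projection_eq_self hW x
    rw [← eq_sub_iff_add_eq] at this
    change _ = x - p x at this
    rw [← this]
    exact Submodule.projection_apply_mem hW x
  have hpc : Continuous p := p.continuous_of_finiteDimensional
  have hplρ : Tendsto (fun g => p (l (ρ g))) (𝓝 1) (𝓝 0) := by
    have := (hpc.tendsto 0).comp hlρ
    rwa [map_zero] at this
  -- The `𝔰`-part of the logarithm commutes with the whole, so it can be divided out inside the
  -- group, leaving the exponential of the `W`-part.
  have hexpp : ∀ᶠ g in 𝓝 (1 : T), exp (p (l (ρ g))) ∈ Set.range ρ := by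
    filter_upwards [hcommL, hρ1.eventually hexpl] with g hg hg3
    have hcD : Commute (l (ρ g) - p (l (ρ g))) (l (ρ g)) :=
      commute_of_forall_commute_exp_smul fun s => by
        obtain ⟨h, hh⟩ := hps (l (ρ g)) s
        rw [← hh]
        exact hg h
    have e : p (l (ρ g)) = l (ρ g) + -(l (ρ g) - p (l (ρ g))) := by abel
    obtain ⟨h, hh⟩ := 𝔰.neg_mem (hps (l (ρ g))) 1
    rw [one_smul] at hh
    rw [e, exp_add_of_commute hcD.symm.neg_right, hg3, ← hh, ← map_mul]
    exact ⟨_, rfl⟩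
  -- Otherwise there are nonzero `W`-parts tending to 0 with exponentials in the group. A limit `u`
  -- of their directions is a unit vector in `W` that generates a one-parameter subgroup, so it also
  -- lies in `𝔰`, contradicting `𝔰 ∩ W = 0`.
  by_contra hcon
  have hseq : ∀ n : ℕ, ∃ g : T, p (l (ρ g)) ≠ 0 ∧ exp (p (l (ρ g))) ∈ Set.range ρ ∧
      ‖p (l (ρ g))‖ < 1 / ((n : ℝ) + 1) := by
    intro n
    have hsmall : ∀ᶠ g in 𝓝 (1 : T), ‖p (l (ρ g))‖ < 1 / ((n : ℝ) + 1) := by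
      have := hplρ.norm
      rw [norm_zero] at this
      exact this.eventually (gt_mem_nhds (by positivity))
    obtain ⟨g, hg, hg1, hg2, hg3⟩ :=
      ((not_eventually.1 hcon).and_eventually (hexpp.and (hsmall.and
        (hρ1.eventually hexpl)))).exists
    refine ⟨g, fun h0 => hg ⟨l (ρ g), ?_, hg3.symm⟩, hg1, hg2⟩
    simpa [h0] using hps (l (ρ g))
  choose g hg0 hgS hgn using hseq
  let b : ℕ → A := fun n => p (l (ρ (g n)))
  have hb0 : Tendsto b atTop (𝓝 0) :=
    squeeze_zero_norm (fun n => (hgn n).le) tendsto_one_div_add_atTop_nhds_zero_nat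
  have hproper : ProperSpace A := FiniteDimensional.proper ℝ A
  obtain ⟨u, hu, φ, hφ, hlim⟩ := (isCompact_sphere (0 : A) 1).tendsto_subseq
    (x := fun n => ‖b n‖⁻¹ • b n) (fun n => by
      simp [norm_smul, inv_mul_cancel₀ (norm_ne_zero_iff.2 (hg0 n) : ‖b n‖ ≠ 0)])
  have hclosed : IsClosed (Set.range ρ) := (isCompact_range hρ).isClosed
  have huS : ∀ s : ℝ, 0 ≤ s → exp (s • u) ∈ Set.range ρ := fun s hs =>
    exp_smul_mem_of_tendsto hclosed (by rintro _ ⟨h, rfl⟩ k; exact ⟨h ^ k, map_pow _ _ _⟩)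
      (b := b ∘ φ) (fun n => hg0 _) (hb0.comp hφ.tendsto_atTop) (fun n => hgS _) hlim hs
  have hus : u ∈ 𝔰 := by
    intro s
    rcases le_total 0 s with hs | hs
    · exact huS s hs
    · obtain ⟨h, hh⟩ := huS (-s) (by linarith)
      refine ⟨h⁻¹, ?_⟩
      have h1 : exp (s • u) * exp (-s • u) = 1 := by
        rw [← exp_add_of_commute (((Commute.refl u).smul_left _).smul_right _)]
        simp
      calc ρ h⁻¹ = exp (s • u) * exp (-s • u) * ρ h⁻¹ := by rw [h1, one_mul]
        _ = exp (s • u) := by rw [mul_assoc, ← hh, hρi, mul_one]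
  have huW : u ∈ W := (W.closed_of_finiteDimensional).mem_of_tendsto hlim
    (Eventually.of_forall fun n => W.smul_mem _ (hpW _))
  have hu0 : u = 0 := by
    have := hW.disjoint.le_bot ⟨hus, huW⟩
    simpa using this
  simp [hu0] at hu

theorem exp_apply_eq_self {V : Type*} [NormedAddCommGroup V] [NormedSpace ℝ V] [CompleteSpace V]
    {D : V →L[ℝ] V} {v : V} (hDv : D v = 0) : exp D v = v := by
  have h2 := (exp_series_hasSum_exp' (𝕂 := ℝ) D).mapL (ContinuousLinearMap.apply ℝ V v)
  have h3 : ∀ n : ℕ, n ≠ 0 →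
      ContinuousLinearMap.apply ℝ V v ((n.factorial : ℝ)⁻¹ • D ^ n) = 0 := fun n hn => by
    obtain ⟨m, rfl⟩ := Nat.exists_eq_succ_of_ne_zero hn
    rw [map_smul, ContinuousLinearMap.apply_apply, pow_succ, mul_apply_eq_comp, hDv, map_zero,
      smul_zero]
  have h4 := hasSum_single 0 h3
  have h5 := h2.unique h4
  simpa using h5

/-- A vector annihilated by all generators of one-parameter subgroups of a compact connected
commutative group is fixed by the group. -/
theorem apply_eq_of_forall_generator_apply_eq_zero {V : Type*} [NormedAddCommGroup V]
    [NormedSpace ℝ V] [FiniteDimensional ℝ V] [IsTopologicalGroup T] [CompactSpace T]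
    [ConnectedSpace T] (ρ : T →* (V →L[ℝ] V)) (hρ : Continuous ρ)
    (hcomm : ∀ g h : T, g * h = h * g) {v : V}
    (hv : ∀ D : V →L[ℝ] V, (∀ s : ℝ, exp (s • D) ∈ Set.range ρ) → D v = 0) (g : T) :
    ρ g v = v := by
  have := FiniteDimensional.complete ℝ V
  let S : Subgroup T :=
    { carrier := {g | ρ g v = v}
      one_mem' := by simp
      mul_mem' := fun {a b} (ha : ρ a v = v) (hb : ρ b v = v) => by
        change ρ (a * b) v = v
        rw [map_mul, mul_apply_eq_comp, hb, ha]
      inv_mem' := fun {a} (ha : ρ a v = v) => by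
        change ρ a⁻¹ v = v
        conv_lhs => rw [← ha]
        rw [← mul_apply_eq_comp, ← map_mul]
        simp }
  -- The stabilizer of `v` contains a neighbourhood of 1, so it is open and closed in a connected
  -- group.
  have hopen : IsOpen (S : Set T) := by
    refine S.isOpen_of_mem_nhds (g := 1) ?_
    filter_upwards [eventually_exists_eq_exp ρ hρ hcomm] with g hg
    obtain ⟨D, hD, hgD⟩ := hg
    change ρ g v = v
    rw [hgD, exp_apply_eq_self (hv D hD)]
  have hcl : IsClopen (S : Set T) := ⟨S.isClosed_of_isOpen hopen, hopen⟩
  have := hcl.eq_univ ⟨1, S.one_mem⟩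
  exact (this ▸ Set.mem_univ g : g ∈ (S : Set T))

end OneParameter

/-! ### Bracket of left invariant fields in a chart -/

section BracketCalculus

open Filter Topology

variable {E : Type*} [NormedAddCommGroup E] [NormedSpace ℝ E]

/-- Let `F` be a multiplication with identity `c`, and let `A x` be the adjoint action of `x` on
`Y`. Then the commutator of the left invariant vector fields of `X` and `Y` is the derivative
of `A` in the direction `X`. -/
theorem fderiv_leftInvariant_sub_fderiv_leftInvariant {F : E × E → E} {c X Y : E}
    (hF : ContDiffAt ℝ ∞ F (c, c)) {A : E → E} (hA : DifferentiableAt ℝ A c) (hAc : A c = Y)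
    (hunit : ∀ v, fderiv ℝ F (c, c) (v, 0) = v)
    (h : ∀ᶠ x in 𝓝 c, fderiv ℝ F (x, c) (0, Y) = fderiv ℝ F (c, x) (A x, 0)) :
    fderiv ℝ (fun x => fderiv ℝ F (x, c) (0, Y)) c X -
      fderiv ℝ (fun x => fderiv ℝ F (x, c) (0, X)) c Y = fderiv ℝ A c X := by
  set D := fderiv ℝ (fderiv ℝ F) (c, c) with hD
  have hd : HasFDerivAt (fderiv ℝ F) D (c, c) :=
    ((hF.fderiv_right (m := ∞) (by simp)).differentiableAt
      (by simp)).hasFDerivAt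
  have hsymm : ∀ v w, D v w = D w v := fun v w =>
    (hF.isSymmSndFDerivAt (by simpa using ENat.LEInfty.out)).eq v w
  have hL : ∀ Z, HasFDerivAt (fun x => fderiv ℝ F (x, c) (0, Z))
      ((D.comp (.inl ℝ E E)).flip (0, Z)) c := fun Z => by
    have h1 : HasFDerivAt (fun x : E => (x, c)) (.inl ℝ E E) c := hasFDerivAt_prodMk_left c c
    simpa using! (HasFDerivAt.comp (f := fun x : E => (x, c)) c hd h1).clm_apply (hasFDerivAt_const ((0, Z) : E × E) c)
  have hR : HasFDerivAt (fun x => fderiv ℝ F (c, x) (A x, 0))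
      ((fderiv ℝ F (c, c)).comp ((fderiv ℝ A c).prod 0) +
        (D.comp (.inr ℝ E E)).flip (A c, 0)) c := by
    have h1 : HasFDerivAt (fun x : E => (c, x)) (.inr ℝ E E) c := hasFDerivAt_prodMk_right c c
    exact (HasFDerivAt.comp (f := fun x : E => (c, x)) c hd h1).clm_apply (hA.hasFDerivAt.prodMk (hasFDerivAt_const (0 : E) c))
  -- Writing the field of `Y` through `A`, its derivative along `X` is that of `A` plus a mixed
  -- second derivative of `F`. By symmetry of `D` that term cancels against the other field.
  rw [(hL X).fderiv, Filter.EventuallyEq.fderiv_eq h, hR.fderiv]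
  simp [hunit, hAc, hsymm (Y, 0)]

end BracketCalculus

/-! ### The adjoint representation and its derivative -/

section Adjoint

open Filter Topology Set

variable {E : Type*} [NormedAddCommGroup E] [NormedSpace ℝ E]
  {G : Type*} [TopologicalSpace G] [ChartedSpace E G] [Group G]

/-- Tangent spaces are all `E` by definition, so a derivative can be moved between base points such
as `h * 1 * h⁻¹` and `1`, as the chain rule requires. -/
theorem HasMFDerivAt.congr_point {M N : Type*} [TopologicalSpace M] [ChartedSpace E M]
    [TopologicalSpace N] [ChartedSpace E N] {f : M → N} {x y : M} {f' : E →L[ℝ] E}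
    (h : HasMFDerivAt 𝓘(ℝ, E) 𝓘(ℝ, E) f x f') (hxy : x = y) :
    HasMFDerivAt 𝓘(ℝ, E) 𝓘(ℝ, E) f y f' := by
  subst hxy; exact h

variable (E) in
/-- The adjoint action of an element of a Lie group on the tangent space at the identity. -/
def adjointAction (g : G) : E →L[ℝ] E :=
  mfderiv 𝓘(ℝ, E) 𝓘(ℝ, E) (fun x : G => g * x * g⁻¹) 1

theorem adjointAction_one : adjointAction E (1 : G) = 1 := by
  have h : (fun x : G => 1 * x * 1⁻¹) = id := by ext; simp
  unfold adjointAction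
  rw [h]
  exact mfderiv_id

variable [LieGroup 𝓘(ℝ, E) ∞ G]

theorem contMDiff_conj (g : G) : ContMDiff 𝓘(ℝ, E) 𝓘(ℝ, E) ∞ (fun x : G => g * x * g⁻¹) :=
  (contMDiff_const.mul contMDiff_id).mul contMDiff_const

theorem hasMFDerivAt_conj (g : G) :
    HasMFDerivAt 𝓘(ℝ, E) 𝓘(ℝ, E) (fun x : G => g * x * g⁻¹) 1 (adjointAction E g) :=
  ((contMDiff_conj g).mdifferentiable (by simp) _).hasMFDerivAt

theorem adjointAction_mul (g h : G) :
    adjointAction E (g * h) = adjointAction E g * adjointAction E h := by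
  have h1 := ((hasMFDerivAt_conj (E := E) g).congr_point
    (show (1 : G) = h * 1 * h⁻¹ by simp)).comp (f := fun x : G => h * x * h⁻¹) _
    (hasMFDerivAt_conj (E := E) h)
  have e : ((fun x : G => g * x * g⁻¹) ∘ fun x : G => h * x * h⁻¹) =
      fun x : G => g * h * x * (g * h)⁻¹ := by
    ext x; simp [mul_assoc]
  rw [e] at h1
  exact hasMFDerivAt_unique (hasMFDerivAt_conj (E := E) (g * h)) h1

variable (E G) in
/-- The adjoint representation. -/
def adjointRep : G →* (E →L[ℝ] E) where
  toFun := adjointAction E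
  map_one' := adjointAction_one
  map_mul' := adjointAction_mul

theorem contMDiff_adjointAction :
    ContMDiff 𝓘(ℝ, E) 𝓘(ℝ, E →L[ℝ] E) ∞ (fun g : G => adjointAction E g) := by
  intro g
  have h1 : ContMDiffAt (𝓘(ℝ, E).prod 𝓘(ℝ, E)) 𝓘(ℝ, E) ∞
      (Function.uncurry fun g x : G => g * x * g⁻¹) (g, 1) :=
    ((contMDiff_fst.mul contMDiff_snd).mul contMDiff_fst.inv).contMDiffAt
  have h2 : ContMDiffAt 𝓘(ℝ, E) 𝓘(ℝ, E →L[ℝ] E) ∞ (inTangentCoordinates 𝓘(ℝ, E) 𝓘(ℝ, E)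
      (fun _ : G => (1 : G)) (fun g : G => g * 1 * g⁻¹) (fun x : G => adjointAction E x) g) g :=
    ContMDiffAt.mfderiv (m := ∞) (fun g x : G => g * x * g⁻¹) (fun _ => 1) h1
      contMDiffAt_const (by simp)
  have e : (fun g : G => g * 1 * g⁻¹) = fun _ => 1 := by ext; simp
  rw [e] at h2
  refine h2.congr_of_eventuallyEq (Eventually.of_forall fun x => ?_)
  -- Every conjugation fixes 1, so both coordinate changes are from the chart at 1 to itself and are
  -- trivial there.
  rw [inTangentCoordinates_eq (fun _ : G => (1 : G)) (fun _ : G => (1 : G))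
    (fun x : G => adjointAction E x) (mem_chart_source E (1 : G)) (mem_chart_source E (1 : G))]
  ext v
  have hc := fun v => (tangentBundleCore 𝓘(ℝ, E) G).coordChange_self (achart E (1 : G)) 1
    (mem_chart_source E (1 : G)) v
  simp only [ContinuousLinearMap.comp_apply]
  erw [hc, hc]

variable (E G) in
/-- The multiplication of a Lie group, read in the preferred chart at the identity. -/
def mulInChart (p : E × E) : E :=
  extChartAt 𝓘(ℝ, E) (1 : G) ((extChartAt 𝓘(ℝ, E) (1 : G)).symm p.1 *
    (extChartAt 𝓘(ℝ, E) (1 : G)).symm p.2)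

theorem contDiffAt_mulInChart :
    ContDiffAt ℝ ∞ (mulInChart E G) (extChartAt 𝓘(ℝ, E) (1 : G) 1, extChartAt 𝓘(ℝ, E) (1 : G) 1) := by
  set c := extChartAt 𝓘(ℝ, E) (1 : G) 1 with hc
  rw [← contMDiffAt_iff_contDiffAt]
  have hψ : ContMDiffAt 𝓘(ℝ, E) 𝓘(ℝ, E) ∞ (extChartAt 𝓘(ℝ, E) (1 : G)).symm c :=
    (contMDiffOn_extChartAt_symm (n := ∞) (1 : G)).contMDiffAt (extChartAt_target_mem_nhds _)
  have h1 : ContMDiffAt 𝓘(ℝ, E × E) 𝓘(ℝ, E) ∞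
      (fun p : E × E => (extChartAt 𝓘(ℝ, E) (1 : G)).symm p.1) (c, c) :=
    ContMDiffAt.comp (c, c) hψ contDiff_fst.contMDiff.contMDiffAt
  have h2 : ContMDiffAt 𝓘(ℝ, E × E) 𝓘(ℝ, E) ∞
      (fun p : E × E => (extChartAt 𝓘(ℝ, E) (1 : G)).symm p.2) (c, c) :=
    ContMDiffAt.comp (c, c) hψ contDiff_snd.contMDiff.contMDiffAt
  refine ContMDiffAt.comp (c, c) (contMDiffAt_extChartAt' ?_) (h1.mul h2)
  simp [hc]

theorem hasMFDerivAt_extChartAt_one :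
    HasMFDerivAt 𝓘(ℝ, E) 𝓘(ℝ, E) (extChartAt 𝓘(ℝ, E) (1 : G)) 1 (ContinuousLinearMap.id ℝ E) := by
  have := (mdifferentiableAt_extChartAt (I := 𝓘(ℝ, E))
    (mem_chart_source E (1 : G))).hasMFDerivAt
  rwa [mfderiv_extChartAt_self] at this

theorem hasMFDerivAt_extChartAt_symm_one :
    HasMFDerivAt 𝓘(ℝ, E) 𝓘(ℝ, E) (extChartAt 𝓘(ℝ, E) (1 : G)).symm
      (extChartAt 𝓘(ℝ, E) (1 : G) 1) (ContinuousLinearMap.id ℝ E) := by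
  have h := mfderivWithin_range_extChartAt_symm (I := 𝓘(ℝ, E)) (x := (1 : G))
  have h1 := (mdifferentiableWithinAt_extChartAt_symm (I := 𝓘(ℝ, E))
    (mem_extChartAt_target (1 : G))).hasMFDerivWithinAt
  rw [h, ModelWithCorners.range_eq_univ] at h1
  exact hasMFDerivWithinAt_univ.1 h1

theorem eventually_differentiableAt_mulInChart :
    ∀ᶠ x in 𝓝 (extChartAt 𝓘(ℝ, E) (1 : G) 1),
      DifferentiableAt ℝ (mulInChart E G) (x, extChartAt 𝓘(ℝ, E) (1 : G) 1) ∧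
      DifferentiableAt ℝ (mulInChart E G) (extChartAt 𝓘(ℝ, E) (1 : G) 1, x) := by
  set c := extChartAt 𝓘(ℝ, E) (1 : G) 1 with hc
  have h1 : ∀ᶠ p in 𝓝 (c, c), DifferentiableAt ℝ (mulInChart E G) p :=
    ((contDiffAt_mulInChart.of_le (m := 1) (ENat.LEInfty.out)).eventually (by simp)).mono
      fun p hp => hp.differentiableAt (by simp)
  have h2 : Tendsto (fun x : E => (x, c)) (𝓝 c) (𝓝 (c, c)) :=
    (Continuous.prodMk continuous_id continuous_const).tendsto c
  have h3 : Tendsto (fun x : E => (c, x)) (𝓝 c) (𝓝 (c, c)) :=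
    (Continuous.prodMk continuous_const continuous_id).tendsto c
  exact (h2.eventually h1).and (h3.eventually h1)

theorem fderiv_mulInChart_unit (v : E) :
    fderiv ℝ (mulInChart E G) (extChartAt 𝓘(ℝ, E) (1 : G) 1, extChartAt 𝓘(ℝ, E) (1 : G) 1) (v, 0) =
      v := by
  set c := extChartAt 𝓘(ℝ, E) (1 : G) 1 with hc
  have hd := (eventually_differentiableAt_mulInChart (E := E) (G := G)).self_of_nhds.1.hasFDerivAt
  have h1 := HasFDerivAt.comp (f := fun x : E => (x, c)) c hd (hasFDerivAt_prodMk_left c c)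
  have h2 : (mulInChart E G ∘ fun x : E => (x, c)) =ᶠ[𝓝 c] id := by
    filter_upwards [extChartAt_target_mem_nhds (I := 𝓘(ℝ, E)) (1 : G)] with x hx
    change extChartAt 𝓘(ℝ, E) (1 : G) (_ * (extChartAt 𝓘(ℝ, E) (1 : G)).symm c) = x
    rw [hc, extChartAt_to_inv, mul_one, (extChartAt 𝓘(ℝ, E) (1 : G)).right_inv hx]
  have h3 := (h1.congr_of_eventuallyEq h2.symm).unique (hasFDerivAt_id c)
  exact DFunLike.congr_fun h3 v

/-- The left invariant vector fields, read in the preferred chart at the identity. -/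
theorem mpullbackWithin_mulInvariantVectorField_eventuallyEq (Y : GroupLieAlgebra 𝓘(ℝ, E) G) :
    (VectorField.mpullbackWithin 𝓘(ℝ, E) 𝓘(ℝ, E) (extChartAt 𝓘(ℝ, E) (1 : G)).symm
      (mulInvariantVectorField Y) (range 𝓘(ℝ, E)) : E → E) =ᶠ[𝓝 (extChartAt 𝓘(ℝ, E) (1 : G) 1)]
      fun x => fderiv ℝ (mulInChart E G) (x, extChartAt 𝓘(ℝ, E) (1 : G) 1) (0, Y) := by
  set c := extChartAt 𝓘(ℝ, E) (1 : G) 1 with hc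
  filter_upwards [extChartAt_target_mem_nhds (I := 𝓘(ℝ, E)) (1 : G),
    eventually_differentiableAt_mulInChart (E := E) (G := G)] with x hx hd
  have h1 := HasFDerivAt.comp (f := fun y : E => (x, y)) c hd.1.hasFDerivAt
    (hasFDerivAt_prodMk_right x c)
  set g := (extChartAt 𝓘(ℝ, E) (1 : G)).symm x with hg
  have hgs : g ∈ (chartAt E (1 : G)).source := by
    rw [← extChartAt_source 𝓘(ℝ, E)]
    exact (extChartAt 𝓘(ℝ, E) (1 : G)).map_target hx
  have h2 : HasMFDerivAt 𝓘(ℝ, E) 𝓘(ℝ, E) (extChartAt 𝓘(ℝ, E) (1 : G)) (g * 1)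
      (mfderiv 𝓘(ℝ, E) 𝓘(ℝ, E) (extChartAt 𝓘(ℝ, E) (1 : G)) g : E →L[ℝ] E) :=
    (mdifferentiableAt_extChartAt hgs).hasMFDerivAt.congr_point (mul_one g).symm
  have h3 : HasMFDerivAt 𝓘(ℝ, E) 𝓘(ℝ, E) (fun y : G => g * y)
      ((extChartAt 𝓘(ℝ, E) (1 : G)).symm c)
      (mfderiv 𝓘(ℝ, E) 𝓘(ℝ, E) (fun y : G => g * y) 1 : E →L[ℝ] E) :=
    (((contMDiff_mul_left (n := ∞)).mdifferentiable (by simp)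
      (1 : G)).hasMFDerivAt).congr_point (by simp [hc])
  have h2' := h2.congr_point (show g * 1 = (fun y : G => g * y)
    ((extChartAt 𝓘(ℝ, E) (1 : G)).symm c) by simp [hc])
  have h4 := (h2'.comp _ h3).comp _ hasMFDerivAt_extChartAt_symm_one
  rw [hasMFDerivAt_iff_hasFDerivAt] at h4
  have h5 : fderiv ℝ (mulInChart E G) (x, c) (0, Y) =
      (mfderiv 𝓘(ℝ, E) 𝓘(ℝ, E) (extChartAt 𝓘(ℝ, E) (1 : G)) g : E →L[ℝ] E)
        ((mfderiv 𝓘(ℝ, E) 𝓘(ℝ, E) (fun y : G => g * y) 1 : E →L[ℝ] E) Y) :=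
    DFunLike.congr_fun (h1.unique h4) Y
  refine Eq.trans ?_ h5.symm
  have h6 : (mfderivWithin 𝓘(ℝ, E) 𝓘(ℝ, E) (extChartAt 𝓘(ℝ, E) (1 : G)).symm (range 𝓘(ℝ, E))
      x).inverse = mfderiv 𝓘(ℝ, E) 𝓘(ℝ, E) (extChartAt 𝓘(ℝ, E) (1 : G)) g :=
    ContinuousLinearMap.inverse_eq (mfderivWithin_extChartAt_symm_comp_mfderiv_extChartAt hx)
      (mfderiv_extChartAt_comp_mfderivWithin_extChartAt_symm hx)
  rw [VectorField.mpullbackWithin_apply, h6]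
  rfl

/-- Left translation by `g` is conjugation by `g` followed by right translation by `g`. -/
theorem fderiv_mulInChart_eventually_eq (Y : E) :
    ∀ᶠ x in 𝓝 (extChartAt 𝓘(ℝ, E) (1 : G) 1),
      fderiv ℝ (mulInChart E G) (x, extChartAt 𝓘(ℝ, E) (1 : G) 1) (0, Y) =
        fderiv ℝ (mulInChart E G) (extChartAt 𝓘(ℝ, E) (1 : G) 1, x)
          (adjointAction E ((extChartAt 𝓘(ℝ, E) (1 : G)).symm x) Y, 0) := by
  set c := extChartAt 𝓘(ℝ, E) (1 : G) 1 with hc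
  filter_upwards [eventually_differentiableAt_mulInChart (E := E) (G := G)] with x hd
  have h1 := HasFDerivAt.comp (f := fun y : E => (x, y)) c hd.1.hasFDerivAt
    (hasFDerivAt_prodMk_right x c)
  set g := (extChartAt 𝓘(ℝ, E) (1 : G)).symm x with hg
  have hψc : (extChartAt 𝓘(ℝ, E) (1 : G)).symm c = 1 := by simp [hc]
  have h3 := (hasMFDerivAt_conj (E := E) g).congr_point hψc.symm
  have h2' := (hasMFDerivAt_extChartAt_one (E := E) (G := G)).congr_point (show 1 = (fun y : G => g * y * g⁻¹)
    ((extChartAt 𝓘(ℝ, E) (1 : G)).symm c) by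
      change 1 = g * _ * g⁻¹
      rw [hψc]; simp)
  have h4 := (HasMFDerivAt.comp (f := fun y : G => g * y * g⁻¹) _ h2' h3).comp _
    hasMFDerivAt_extChartAt_symm_one
  rw [hasMFDerivAt_iff_hasFDerivAt] at h4
  set κ := ((extChartAt 𝓘(ℝ, E) (1 : G) ∘ fun y : G => g * y * g⁻¹) ∘
    (extChartAt 𝓘(ℝ, E) (1 : G)).symm) with hκ
  have hκc : κ c = c := by simp [hκ, hc]
  have h5 : HasFDerivAt (fun z : E => (z, x)) (ContinuousLinearMap.inl ℝ E E) (κ c) :=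
    hasFDerivAt_prodMk_left _ _
  have h6 : HasFDerivAt (mulInChart E G) (fderiv ℝ (mulInChart E G) (c, x)) (κ c, x) := by
    rw [hκc]; exact hd.2.hasFDerivAt
  have h7 := (HasFDerivAt.comp (f := fun z : E => (z, x)) _ h6 h5).comp c h4
  -- In the group this is `g * y = (g * y * g⁻¹) * g`; it passes to the chart as long as the
  -- conjugate stays in the chart's source.
  have h8 : (mulInChart E G ∘ fun y : E => (x, y)) =ᶠ[𝓝 c]
      ((mulInChart E G ∘ fun z : E => (z, x)) ∘ κ) := by
    have hs : ∀ᶠ y in 𝓝 c, g * (extChartAt 𝓘(ℝ, E) (1 : G)).symm y * g⁻¹ ∈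
        (extChartAt 𝓘(ℝ, E) (1 : G)).source := by
      have hc1 : ContinuousAt (fun y => g * (extChartAt 𝓘(ℝ, E) (1 : G)).symm y * g⁻¹) c :=
        (HasMFDerivAt.comp (g := fun y : G => g * y * g⁻¹) c h3
          hasMFDerivAt_extChartAt_symm_one).continuousAt
      refine hc1.preimage_mem_nhds ?_
      simp only [hψc, mul_one, mul_inv_cancel]
      exact extChartAt_source_mem_nhds _
    filter_upwards [hs] with y hy
    simp only [mulInChart, Function.comp_apply, hκ]
    rw [(extChartAt 𝓘(ℝ, E) (1 : G)).left_inv hy, ← hg]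
    simp
  have h9 := DFunLike.congr_fun ((h1.congr_of_eventuallyEq h8.symm).unique h7) Y
  simpa using! h9

theorem differentiableAt_adjointAction_extChartAt_symm (Y : E) : DifferentiableAt ℝ
    (fun x : E => adjointAction E ((extChartAt 𝓘(ℝ, E) (1 : G)).symm x) Y)
    (extChartAt 𝓘(ℝ, E) (1 : G) 1) := by
  have h1 := (contMDiff_adjointAction (E := E) (G := G)).mdifferentiable (by simp)
    ((extChartAt 𝓘(ℝ, E) (1 : G)).symm (extChartAt 𝓘(ℝ, E) (1 : G) 1))
  have h2 := h1.comp _ hasMFDerivAt_extChartAt_symm_one.mdifferentiableAt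
  rw [mdifferentiableAt_iff_differentiableAt] at h2
  exact h2.clm_apply (differentiableAt_const Y)

/-- The derivative of the adjoint representation is the adjoint representation of the
Lie algebra. -/
theorem fderiv_adjointAction_extChartAt_symm [CompleteSpace E] (X Y : GroupLieAlgebra 𝓘(ℝ, E) G) :
    fderiv ℝ (fun x : E => adjointAction E ((extChartAt 𝓘(ℝ, E) (1 : G)).symm x) Y)
      (extChartAt 𝓘(ℝ, E) (1 : G) 1) X = ⁅X, Y⁆ := by
  set c := extChartAt 𝓘(ℝ, E) (1 : G) 1 with hc
  have hAc : adjointAction E ((extChartAt 𝓘(ℝ, E) (1 : G)).symm c) Y = Y := by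
    rw [hc, extChartAt_to_inv, adjointAction_one]; rfl
  have key := fderiv_leftInvariant_sub_fderiv_leftInvariant (E := E) (X := X) (Y := Y) contDiffAt_mulInChart
    (differentiableAt_adjointAction_extChartAt_symm (E := E) Y) hAc fderiv_mulInChart_unit (fderiv_mulInChart_eventually_eq (E := E) Y)
  refine key.symm.trans ?_
  let V : GroupLieAlgebra 𝓘(ℝ, E) G → E → E := fun Z => VectorField.mpullbackWithin 𝓘(ℝ, E) 𝓘(ℝ, E)
    (extChartAt 𝓘(ℝ, E) (1 : G)).symm (mulInvariantVectorField Z) (range 𝓘(ℝ, E))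
  have hV' : ∀ Z, V Z =ᶠ[𝓝 c] fun x => fderiv ℝ (mulInChart E G) (x, c) (0, Z) :=
    mpullbackWithin_mulInvariantVectorField_eventuallyEq
  have hV : ∀ Z, V Z c = Z := fun Z => by
    have h2 := (fderiv_mulInChart_eventually_eq (E := E) (G := G) Z).self_of_nhds
    rw [fderiv_mulInChart_unit, extChartAt_to_inv, adjointAction_one] at h2
    exact (hV' Z).self_of_nhds.trans h2
  have hinv : ∀ f : E →L[ℝ] E, f = .id ℝ E → ∀ w, f.inverse w = w := by
    rintro _ rfl w
    rw [ContinuousLinearMap.inverse_id]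
    rfl
  have hset : (extChartAt 𝓘(ℝ, E) (1 : G)).symm ⁻¹' univ ∩ range 𝓘(ℝ, E) = univ := by simp
  -- The chart at 1 has identity differential at 1, so the bracket on the manifold is the plain
  -- bracket of the fields read in the chart.
  have hb : ⁅X, Y⁆ = VectorField.lieBracket ℝ (V X) (V Y) c := by
    rw [GroupLieAlgebra.bracket_def, ← VectorField.mlieBracketWithin_univ,
      VectorField.mlieBracketWithin_apply, hset]
    exact (hinv _ mfderiv_extChartAt_self _).trans
      (congrFun (VectorField.lieBracketWithin_univ (V := V X) (W := V Y)) c)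
  refine Eq.trans ?_ hb.symm
  change _ = fderiv ℝ (V Y) c (V X c) - fderiv ℝ (V X) c (V Y c)
  rw [hV, hV, (hV' X).fderiv_eq, (hV' Y).fderiv_eq]

end Adjoint

/-! ### One-parameter subgroups of a Lie group -/

section OneParameterSubgroups

open Filter Topology Set

variable {E : Type*} [NormedAddCommGroup E] [NormedSpace ℝ E]
  {G : Type*} [TopologicalSpace G] [ChartedSpace E G] [Group G]

theorem mulInvariantVectorField_apply_one (X : GroupLieAlgebra 𝓘(ℝ, E) G) :
    mulInvariantVectorField X (1 : G) = X := by
  have e : (fun x : G => 1 * x) = id := by ext; simp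
  unfold mulInvariantVectorField
  rw [e, mfderiv_id]
  rfl

variable [LieGroup 𝓘(ℝ, E) ∞ G]

theorem contMDiff_mulInvariantVectorField_one (X : GroupLieAlgebra 𝓘(ℝ, E) G) :
    ContMDiff 𝓘(ℝ, E) 𝓘(ℝ, E).tangent 1
      (fun g : G => (⟨g, mulInvariantVectorField X g⟩ : TangentBundle 𝓘(ℝ, E) G)) :=
  (contMDiff_mulInvariantVectorField X).of_le (le_trans (by norm_num) le_minSmoothness)

/-- Differentiate `f ∘ (h * ·) = (f h * ·) ∘ k` at 1. The form with two maps covers left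
translations (`k = id`) and homomorphisms (`k = f`) at once. -/
theorem mfderiv_mulInvariantVectorField {f k : G → G} (hf : ContMDiff 𝓘(ℝ, E) 𝓘(ℝ, E) ∞ f)
    (hk : ContMDiff 𝓘(ℝ, E) 𝓘(ℝ, E) ∞ k) (hk1 : k 1 = 1) (hfk : ∀ h x, f (h * x) = f h * k x)
    (X : GroupLieAlgebra 𝓘(ℝ, E) G) (h : G) :
    (mfderiv 𝓘(ℝ, E) 𝓘(ℝ, E) f h : E →L[ℝ] E) (mulInvariantVectorField X h) =
      mulInvariantVectorField ((mfderiv 𝓘(ℝ, E) 𝓘(ℝ, E) k 1 : E →L[ℝ] E) X :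
        GroupLieAlgebra 𝓘(ℝ, E) G) (f h) := by
  have hl : ∀ g : G, HasMFDerivAt 𝓘(ℝ, E) 𝓘(ℝ, E) (fun y : G => g * y) 1
      (mfderiv 𝓘(ℝ, E) 𝓘(ℝ, E) (fun y : G => g * y) 1 : E →L[ℝ] E) := fun g =>
    ((contMDiff_mul_left (n := ∞)).mdifferentiable (by simp) (1 : G)).hasMFDerivAt
  have h1 : HasMFDerivAt 𝓘(ℝ, E) 𝓘(ℝ, E) f ((fun y : G => h * y) 1)
      (mfderiv 𝓘(ℝ, E) 𝓘(ℝ, E) f h : E →L[ℝ] E) :=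
    (hf.mdifferentiable (by simp) h).hasMFDerivAt.congr_point (by simp)
  have h2 := h1.comp (f := fun y : G => h * y) 1 (hl h)
  have h3 := ((hl (f h)).congr_point hk1.symm).comp (f := k) 1
    (hk.mdifferentiable (by simp) 1).hasMFDerivAt
  have e : (f ∘ fun y : G => h * y) = (fun y : G => f h * y) ∘ k := by
    ext x; exact hfk h x
  rw [e] at h2
  exact DFunLike.congr_fun (hasMFDerivAt_unique h2 h3) X

/-- A map that intertwines left translations maps integral curves of left invariant vector
fields to such integral curves. -/
theorem IsMIntegralCurveOn.comp_of_map_mul {f k : G → G} (hf : ContMDiff 𝓘(ℝ, E) 𝓘(ℝ, E) ∞ f)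
    (hk : ContMDiff 𝓘(ℝ, E) 𝓘(ℝ, E) ∞ k) (hk1 : k 1 = 1) (hfk : ∀ h x, f (h * x) = f h * k x)
    {X : GroupLieAlgebra 𝓘(ℝ, E) G} {γ : ℝ → G} {s : Set ℝ}
    (hγ : IsMIntegralCurveOn (I := 𝓘(ℝ, E)) γ (mulInvariantVectorField X) s) :
    IsMIntegralCurveOn (I := 𝓘(ℝ, E)) (f ∘ γ) (mulInvariantVectorField
      ((mfderiv 𝓘(ℝ, E) 𝓘(ℝ, E) k 1 : E →L[ℝ] E) X : GroupLieAlgebra 𝓘(ℝ, E) G)) s := by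
  intro t ht
  have h1 := (hf.mdifferentiable (by simp) (γ t)).hasMFDerivAt.comp_hasMFDerivWithinAt t (hγ t ht)
  have h2 := mfderiv_mulInvariantVectorField hf hk hk1 hfk X (γ t)
  have h3 : ((mfderiv 𝓘(ℝ, E) 𝓘(ℝ, E) f (γ t) : E →L[ℝ] E).comp
      ((1 : ℝ →L[ℝ] ℝ).smulRight (mulInvariantVectorField X (γ t) : E))) =
      (1 : ℝ →L[ℝ] ℝ).smulRight ((mfderiv 𝓘(ℝ, E) 𝓘(ℝ, E) f (γ t) : E →L[ℝ] E)
        (mulInvariantVectorField X (γ t))) := by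
    ext; simp
  rw [h2] at h3
  exact h3 ▸ h1

theorem IsMIntegralCurve.comp_of_map_mul {f k : G → G} (hf : ContMDiff 𝓘(ℝ, E) 𝓘(ℝ, E) ∞ f)
    (hk : ContMDiff 𝓘(ℝ, E) 𝓘(ℝ, E) ∞ k) (hk1 : k 1 = 1) (hfk : ∀ h x, f (h * x) = f h * k x)
    {X : GroupLieAlgebra 𝓘(ℝ, E) G} {γ : ℝ → G}
    (hγ : IsMIntegralCurve (I := 𝓘(ℝ, E)) γ (mulInvariantVectorField X)) :
    IsMIntegralCurve (I := 𝓘(ℝ, E)) (f ∘ γ) (mulInvariantVectorField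
      ((mfderiv 𝓘(ℝ, E) 𝓘(ℝ, E) k 1 : E →L[ℝ] E) X : GroupLieAlgebra 𝓘(ℝ, E) G)) := by
  rw [isMIntegralCurve_iff_isMIntegralCurveOn] at hγ ⊢
  exact hγ.comp_of_map_mul hf hk hk1 hfk

theorem IsMIntegralCurveOn.mul_left {X : GroupLieAlgebra 𝓘(ℝ, E) G} {γ : ℝ → G} {s : Set ℝ}
    (hγ : IsMIntegralCurveOn (I := 𝓘(ℝ, E)) γ (mulInvariantVectorField X) s) (g : G) :
    IsMIntegralCurveOn (I := 𝓘(ℝ, E)) (fun t => g * γ t) (mulInvariantVectorField X) s := by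
  have h := hγ.comp_of_map_mul (f := fun x => g * x) (k := id) (contMDiff_mul_left (n := ∞))
    contMDiff_id rfl (fun h x => (mul_assoc _ _ _).symm)
  rw [mfderiv_id] at h
  exact h

/-- A one-parameter subgroup with the given initial velocity. -/
def IsOneParameterSubgroup (X : GroupLieAlgebra 𝓘(ℝ, E) G) (γ : ℝ → G) : Prop :=
  γ 0 = 1 ∧ IsMIntegralCurve (I := 𝓘(ℝ, E)) γ (mulInvariantVectorField X)

variable {X : GroupLieAlgebra 𝓘(ℝ, E) G} {γ : ℝ → G}

theorem IsOneParameterSubgroup.map {f : G →* G} (hf : ContMDiff 𝓘(ℝ, E) 𝓘(ℝ, E) ∞ f)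
    (h : IsOneParameterSubgroup X γ) :
    IsOneParameterSubgroup ((mfderiv 𝓘(ℝ, E) 𝓘(ℝ, E) f 1 : E →L[ℝ] E) X :
      GroupLieAlgebra 𝓘(ℝ, E) G) (f ∘ γ) :=
  ⟨by simp [h.1], h.2.comp_of_map_mul hf hf (map_one f) (map_mul f)⟩

theorem IsOneParameterSubgroup.conj (h : IsOneParameterSubgroup X γ) (g : G) :
    IsOneParameterSubgroup (adjointAction E g X : GroupLieAlgebra 𝓘(ℝ, E) G)
      (fun t => g * γ t * g⁻¹) :=
  h.map (f := (MulAut.conj g).toMonoidHom) (contMDiff_conj g)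

theorem mfderiv_adjointAction {f : G →* G} (hf : ContMDiff 𝓘(ℝ, E) 𝓘(ℝ, E) ∞ f) (g : G) (Y : E) :
    (mfderiv 𝓘(ℝ, E) 𝓘(ℝ, E) f 1 : E →L[ℝ] E) (adjointAction E g Y) =
      adjointAction E (f g) ((mfderiv 𝓘(ℝ, E) 𝓘(ℝ, E) f 1 : E →L[ℝ] E) Y) := by
  have h1 : HasMFDerivAt 𝓘(ℝ, E) 𝓘(ℝ, E) f 1 (mfderiv 𝓘(ℝ, E) 𝓘(ℝ, E) f 1 : E →L[ℝ] E) :=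
    (hf.mdifferentiable (by simp) 1).hasMFDerivAt
  have h2 := (h1.congr_point (show (1 : G) = (fun x : G => g * x * g⁻¹) 1 by simp)).comp 1
    (hasMFDerivAt_conj (E := E) g)
  have h3 := ((hasMFDerivAt_conj (E := E) (f g)).congr_point (map_one f).symm).comp 1 h1
  have e : (f ∘ fun x : G => g * x * g⁻¹) = (fun x : G => f g * x * (f g)⁻¹) ∘ f := by
    ext x; simp
  rw [e] at h2
  exact DFunLike.congr_fun (hasMFDerivAt_unique h2 h3) Y

theorem IsOneParameterSubgroup.unique [T2Space G] (h : IsOneParameterSubgroup X γ) {γ' : ℝ → G}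
    (h' : IsOneParameterSubgroup X γ') : γ = γ' :=
  isMIntegralCurve_Ioo_eq_of_contMDiff_boundaryless (t₀ := 0)
    (contMDiff_mulInvariantVectorField_one X) h.2 h'.2 (h.1.trans h'.1.symm)

theorem IsOneParameterSubgroup.map_add [T2Space G] (h : IsOneParameterSubgroup X γ) (s t : ℝ) :
    γ (s + t) = γ s * γ t := by
  have h1 : IsMIntegralCurve (I := 𝓘(ℝ, E)) (γ ∘ (· + s)) (mulInvariantVectorField X) :=
    h.2.comp_add s
  have h2 : IsMIntegralCurve (I := 𝓘(ℝ, E)) (fun t => γ s * γ t) (mulInvariantVectorField X) := by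
    have := h.2
    rw [isMIntegralCurve_iff_isMIntegralCurveOn] at this ⊢
    exact this.mul_left _
  have := isMIntegralCurve_Ioo_eq_of_contMDiff_boundaryless (t₀ := 0)
    (contMDiff_mulInvariantVectorField_one X) h1 h2 (by simp [h.1])
  rw [add_comm]
  exact congrFun this t

theorem IsOneParameterSubgroup.hasDerivAt_extChartAt_zero (h : IsOneParameterSubgroup X γ) :
    HasDerivAt (extChartAt 𝓘(ℝ, E) (1 : G) ∘ γ) (X : E) 0 := by
  have h1 : HasMFDerivAt 𝓘(ℝ, ℝ) 𝓘(ℝ, E) γ 0 ((1 : ℝ →L[ℝ] ℝ).smulRight (X : E)) := by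
    have h2 := h.2 0
    have h3 : (mulInvariantVectorField X (γ 0) : E) = X := by
      rw [h.1]; exact mulInvariantVectorField_apply_one X
    have h4 : ((1 : ℝ →L[ℝ] ℝ).smulRight (mulInvariantVectorField X (γ 0) : E)) =
      (1 : ℝ →L[ℝ] ℝ).smulRight (X : E) :=
      congrArg (fun w : E => (1 : ℝ →L[ℝ] ℝ).smulRight w) h3
    exact h4 ▸ h2
  have h5 := ((hasMFDerivAt_extChartAt_one (E := E) (G := G)).congr_point h.1.symm).comp 0 h1
  rw [hasMFDerivAt_iff_hasFDerivAt] at h5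
  have h6 : HasFDerivAt (extChartAt 𝓘(ℝ, E) (1 : G) ∘ γ) ((1 : ℝ →L[ℝ] ℝ).smulRight (X : E)) 0 := h5
  have h7 := HasFDerivAt.hasDerivAt (F := E) h6
  have h8 : (1 : ℝ →L[ℝ] ℝ).smulRight (X : E) 1 = (X : E) := one_smul ℝ (X : E)
  exact h8 ▸ h7

variable [CompleteSpace E]

/-- Left translates of a local integral curve through 1 give the same existence time at every point,
so integral curves extend to all of `ℝ`. -/
theorem exists_isOneParameterSubgroup [T2Space G] (X : GroupLieAlgebra 𝓘(ℝ, E) G) :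
    ∃ γ : ℝ → G, IsOneParameterSubgroup X γ := by
  have hv := contMDiff_mulInvariantVectorField_one X
  obtain ⟨γ, hγ0, hγ⟩ := exists_isMIntegralCurveAt_of_contMDiffAt_boundaryless (I := 𝓘(ℝ, E)) 0
    (hv.contMDiffAt (x := 1))
  obtain ⟨ε, hε, hball⟩ := Metric.eventually_nhds_iff_ball.1 hγ
  rw [Real.ball_eq_Ioo, zero_sub, zero_add] at hball
  have hon : IsMIntegralCurveOn (I := 𝓘(ℝ, E)) γ (mulInvariantVectorField X) (Ioo (-ε) ε) :=
    fun t ht => (hball t ht).hasMFDerivWithinAt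
  exact exists_isMIntegralCurve_of_isMIntegralCurveOn hv hε
    (fun x => ⟨fun t => x * γ t, by simp [hγ0], hon.mul_left x⟩) 1

theorem IsOneParameterSubgroup.hasDerivAt_adjointAction_zero (h : IsOneParameterSubgroup X γ)
    (Y : GroupLieAlgebra 𝓘(ℝ, E) G) :
    HasDerivAt (fun s => adjointAction E (γ s) Y) (⁅X, Y⁆ : GroupLieAlgebra 𝓘(ℝ, E) G) 0 := by
  have h1 := h.hasDerivAt_extChartAt_zero
  have h2 : HasFDerivAt (fun x : E => adjointAction E ((extChartAt 𝓘(ℝ, E) (1 : G)).symm x) Y)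
      (fderiv ℝ (fun x : E => adjointAction E ((extChartAt 𝓘(ℝ, E) (1 : G)).symm x) Y)
        (extChartAt 𝓘(ℝ, E) (1 : G) 1)) ((extChartAt 𝓘(ℝ, E) (1 : G) ∘ γ) 0) := by
    rw [Function.comp_apply, h.1]
    exact (differentiableAt_adjointAction_extChartAt_symm (E := E) Y).hasFDerivAt
  have h3 := h2.comp_hasDerivAt 0 h1
  have h4 := fderiv_adjointAction_extChartAt_symm X Y
  have h5 : (fun s => adjointAction E (γ s) Y) =ᶠ[𝓝 0]
      ((fun x : E => adjointAction E ((extChartAt 𝓘(ℝ, E) (1 : G)).symm x) Y) ∘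
        (extChartAt 𝓘(ℝ, E) (1 : G) ∘ γ)) := by
    have hc : ContinuousAt γ 0 := (h.2 0).continuousAt
    have hs : ∀ᶠ s in 𝓝 0, γ s ∈ (extChartAt 𝓘(ℝ, E) (1 : G)).source := by
      refine hc.preimage_mem_nhds ?_
      rw [h.1]; exact extChartAt_source_mem_nhds _
    filter_upwards [hs] with s hs
    simp only [Function.comp_apply]
    rw [(extChartAt 𝓘(ℝ, E) (1 : G)).left_inv hs]
  have h6 := h3.congr_of_eventuallyEq h5
  exact h4 ▸ h6

/-- The differential at the identity of a self-map of a Lie group. -/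
def lieDifferential (f : G → G) (X : GroupLieAlgebra 𝓘(ℝ, E) G) : GroupLieAlgebra 𝓘(ℝ, E) G :=
  (mfderiv 𝓘(ℝ, E) 𝓘(ℝ, E) f 1 : E →L[ℝ] E) X

/-- Along a one-parameter subgroup `γ` with velocity `X`, differentiate at 0 the relation by which
`f` intertwines the adjoint actions of `γ s` and `f (γ s)`. -/
theorem lieDifferential_lie [T2Space G] {f : G →* G} (hf : ContMDiff 𝓘(ℝ, E) 𝓘(ℝ, E) ∞ f)
    (X Y : GroupLieAlgebra 𝓘(ℝ, E) G) :
    lieDifferential f ⁅X, Y⁆ = ⁅lieDifferential f X, lieDifferential f Y⁆ := by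
  obtain ⟨γ, hγ⟩ := exists_isOneParameterSubgroup X
  let D : E →L[ℝ] E := mfderiv 𝓘(ℝ, E) 𝓘(ℝ, E) f 1
  have h1 : HasDerivAt (fun s => D (adjointAction E (γ s) Y)) (lieDifferential f ⁅X, Y⁆ : E) 0 :=
    D.hasFDerivAt.comp_hasDerivAt (F := E) 0 (hγ.hasDerivAt_adjointAction_zero Y)
  have h2 := (hγ.map hf).hasDerivAt_adjointAction_zero (lieDifferential f Y)
  exact HasDerivAt.unique (F := E) h1 (h2.congr_of_eventuallyEq
    (Eventually.of_forall fun s => mfderiv_adjointAction hf (γ s) Y))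

end OneParameterSubgroups

/-! ### An invariant inner product by averaging -/

section InvariantInnerProduct

open Filter Topology Set MeasureTheory

variable {E : Type*} [NormedAddCommGroup E] [NormedSpace ℝ E]
  {G : Type*} [TopologicalSpace G] [ChartedSpace E G] [Group G] [LieGroup 𝓘(ℝ, E) ∞ G]

theorem continuous_adjointAction : Continuous (fun g : G => adjointAction E g) :=
  contMDiff_adjointAction.continuous

theorem adjointAction_inv_apply (g : G) (X : E) :
    adjointAction E g (adjointAction E g⁻¹ X) = X := by
  have h := adjointAction_mul (E := E) g g⁻¹
  rw [mul_inv_cancel, adjointAction_one] at h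
  exact (DFunLike.congr_fun h X).symm

variable [FiniteDimensional ℝ E]

/-- A compact Lie group has an invariant inner product on its Lie algebra. -/
theorem exists_adjointAction_invariant_inner [CompactSpace G] [IsTopologicalGroup G] [T2Space G] :
    ∃ B : E →ₗ[ℝ] E →ₗ[ℝ] ℝ, (∀ X Y, B X Y = B Y X) ∧ (∀ X, X ≠ 0 → 0 < B X X) ∧
      ∀ (g : G) (X Y : E), B (adjointAction E g X) (adjointAction E g Y) = B X Y := by
  let _ : MeasurableSpace G := borel G
  have _ : BorelSpace G := ⟨rfl⟩
  let b := Module.finBasis ℝ E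
  let μ : Measure G := Measure.haar
  have hcoord : ∀ i (X : E), Continuous fun g : G => b.coord i (adjointAction E g⁻¹ X) :=
    fun i X => (LinearMap.continuous_of_finiteDimensional (b.coord i)).comp
      ((continuous_adjointAction.comp continuous_inv).clm_apply continuous_const)
  -- The coordinate dot product is averaged over Haar measure. The inverse of `g` makes left
  -- invariance of the measure the property needed.
  let q : E → E → G → ℝ := fun X Y g => ∑ i, b.coord i (adjointAction E g⁻¹ X) *
    b.coord i (adjointAction E g⁻¹ Y)
  have hq : ∀ X Y, Continuous (q X Y) := fun X Y =>
    continuous_finsetSum _ fun i _ => (hcoord i X).mul (hcoord i Y)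
  have hqi : ∀ X Y, Integrable (q X Y) μ := fun X Y =>
    (hq X Y).integrable_of_hasCompactSupport (HasCompactSupport.of_compactSpace _)
  let B : E →ₗ[ℝ] E →ₗ[ℝ] ℝ := LinearMap.mk₂ ℝ (fun X Y => ∫ g, q X Y g ∂μ)
    (fun X X' Y => by
      rw [← integral_add (hqi _ _) (hqi _ _)]
      congr 1; ext g; simp [q, add_mul, Finset.sum_add_distrib])
    (fun c X Y => by
      rw [smul_eq_mul, ← integral_const_mul]
      congr 1; ext g; simp [q, Finset.mul_sum, mul_assoc])
    (fun X Y Y' => by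
      rw [← integral_add (hqi _ _) (hqi _ _)]
      congr 1; ext g; simp [q, mul_add, Finset.sum_add_distrib])
    (fun c X Y => by
      rw [smul_eq_mul, ← integral_const_mul]
      congr 1; ext g; simp [q, Finset.mul_sum, mul_left_comm])
  have hB : ∀ X Y, B X Y = ∫ g, q X Y g ∂μ := fun X Y => rfl
  refine ⟨B, fun X Y => ?_, fun X hX => ?_, fun h X Y => ?_⟩
  · rw [hB, hB]
    congr 1; ext g; simp [q, mul_comm]
  · rw [hB]
    have hnn : ∀ g, 0 ≤ q X X g := fun g => Finset.sum_nonneg fun i _ => mul_self_nonneg _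
    refine (hq X X).integral_pos_of_hasCompactSupport_nonneg_nonzero
      (HasCompactSupport.of_compactSpace _) hnn (x := 1) fun h0 => hX ?_
    rw [Finset.sum_eq_zero_iff_of_nonneg fun i _ => mul_self_nonneg _] at h0
    refine b.ext_elem fun i => ?_
    have := h0 i (Finset.mem_univ i)
    simpa [adjointAction_one] using this
  · rw [hB, hB, ← integral_mul_left_eq_self (q X Y) h⁻¹]
    congr 1; ext g
    simp only [q, mul_inv_rev, inv_inv, adjointAction_mul]
    rfl

variable [CompleteSpace E] [T2Space G]

theorem lie_apply_add_apply_lie_eq_zero {B : E →ₗ[ℝ] E →ₗ[ℝ] ℝ}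
    (hB : ∀ (g : G) (X Y : E), B (adjointAction E g X) (adjointAction E g Y) = B X Y)
    (X Y Z : GroupLieAlgebra 𝓘(ℝ, E) G) :
    B (⁅X, Y⁆ : GroupLieAlgebra 𝓘(ℝ, E) G) Z = -B Y (⁅X, Z⁆ : GroupLieAlgebra 𝓘(ℝ, E) G) := by
  obtain ⟨γ, hγ⟩ := exists_isOneParameterSubgroup X
  have h1 := hγ.hasDerivAt_adjointAction_zero Y
  have h2 := hγ.hasDerivAt_adjointAction_zero Z
  have h3 := (B.toContinuousBilinearMap).isBoundedBilinearMap.hasFDerivAt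
    (adjointAction E (γ 0) Y, adjointAction E (γ 0) Z)
  have h4 := h3.comp_hasDerivAt 0 (HasDerivAt.prodMk (F := E) (G := E) h1 h2)
  have h5 : (fun s : ℝ => B (adjointAction E (γ s) Y) (adjointAction E (γ s) Z)) =
      fun _ => B Y Z := funext fun s => hB _ _ _
  have h6 : HasDerivAt (fun s : ℝ => B (adjointAction E (γ s) Y) (adjointAction E (γ s) Z)) 0 0 := by
    rw [h5]; exact hasDerivAt_const _ _
  have h7 := h4.unique h6
  have h8 : B (adjointAction E (γ 0) Y) (⁅X, Z⁆ : GroupLieAlgebra 𝓘(ℝ, E) G) +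
      B (⁅X, Y⁆ : GroupLieAlgebra 𝓘(ℝ, E) G) (adjointAction E (γ 0) Z) = 0 := h7
  rw [hγ.1, adjointAction_one] at h8
  have h9 : B Y (⁅X, Z⁆ : GroupLieAlgebra 𝓘(ℝ, E) G) +
      B (⁅X, Y⁆ : GroupLieAlgebra 𝓘(ℝ, E) G) Z = 0 := h8
  linarith

end InvariantInnerProduct

/-! ### Maximal tori and one-parameter subgroups -/

section MaximalTori

open Filter Topology Set NormedSpace

variable {E : Type*} [NormedAddCommGroup E] [NormedSpace ℝ E]
  {G : Type*} [TopologicalSpace G] [ChartedSpace E G] [Group G] [LieGroup 𝓘(ℝ, E) ∞ G]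

variable {X Y : GroupLieAlgebra 𝓘(ℝ, E) G} {γ : ℝ → G}

theorem IsOneParameterSubgroup.velocity_unique (h : IsOneParameterSubgroup X γ)
    (h' : IsOneParameterSubgroup Y γ) : X = Y :=
  HasDerivAt.unique (F := E) h.hasDerivAt_extChartAt_zero h'.hasDerivAt_extChartAt_zero

theorem IsOneParameterSubgroup.lie_eq_zero [CompleteSpace E] (h : IsOneParameterSubgroup X γ)
    (hY : ∀ s, adjointAction E (γ s) Y = Y) : ⁅X, Y⁆ = 0 := by
  have h1 := h.hasDerivAt_adjointAction_zero Y
  simp only [hY] at h1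
  exact HasDerivAt.unique (F := E) h1 (hasDerivAt_const (F := E) (0 : ℝ) (Y : E))

/-- The vectors fixed by the differential of `f` and by the adjoint action of `T`, as a subspace. -/
def adjointFixed (f : G →* G) (T : Subgroup G) : Submodule ℝ (GroupLieAlgebra 𝓘(ℝ, E) G) where
  carrier := {X | lieDifferential f X = X ∧ ∀ g ∈ T, adjointAction E g X = X}
  zero_mem' := ⟨ContinuousLinearMap.map_zero (M₁ := E) (M₂ := E) _,
    fun g _ => ContinuousLinearMap.map_zero _⟩
  add_mem' := by
    rintro X Y ⟨hX, hX'⟩ ⟨hY, hY'⟩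
    refine ⟨?_, fun g hg => ?_⟩
    · conv_rhs => rw [← hX, ← hY]
      exact ContinuousLinearMap.map_add (M₁ := E) (M₂ := E) _ X Y
    · conv_rhs => rw [← hX' g hg, ← hY' g hg]
      exact ContinuousLinearMap.map_add (M₁ := E) (M₂ := E) _ X Y
  smul_mem' := by
    rintro c X ⟨hX, hX'⟩
    refine ⟨?_, fun g hg => ?_⟩
    · conv_rhs => rw [← hX]
      exact ContinuousLinearMap.map_smul (M₁ := E) (M₂ := E) _ c X
    · conv_rhs => rw [← hX' g hg]
      exact ContinuousLinearMap.map_smul (M₁ := E) (M₂ := E) _ c X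

variable [T2Space G]

theorem IsOneParameterSubgroup.conj_eq_iff (h : IsOneParameterSubgroup X γ) (g : G) :
    adjointAction E g X = X ↔ ∀ t, g * γ t * g⁻¹ = γ t := by
  constructor
  · intro hg t
    have h1 := h.conj g
    rw [hg] at h1
    exact congrFun (h1.unique h) t
  · intro hg
    have h1 := h.conj g
    simp only [hg] at h1
    exact h1.velocity_unique h

theorem IsOneParameterSubgroup.map_eq_iff (h : IsOneParameterSubgroup X γ) {f : G →* G}
    (hf : ContMDiff 𝓘(ℝ, E) 𝓘(ℝ, E) ∞ f) :
    lieDifferential f X = X ↔ ∀ t, f (γ t) = γ t := by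
  have h1 : IsOneParameterSubgroup (lieDifferential f X) (f ∘ γ) := h.map hf
  constructor
  · intro hg t
    rw [hg] at h1
    exact congrFun (h1.unique h) t
  · intro hg
    have e : f ∘ γ = γ := funext hg
    rw [e] at h1
    exact h1.velocity_unique h

theorem IsOneParameterSubgroup.map_neg (h : IsOneParameterSubgroup X γ) (t : ℝ) :
    γ (-t) = (γ t)⁻¹ := by
  rw [eq_inv_iff_mul_eq_one, ← h.map_add, neg_add_cancel, h.1]

/-- A one-parameter subgroup that is locally contained in a subgroup is contained in it. -/
theorem IsOneParameterSubgroup.mem_of_eventually_mem (h : IsOneParameterSubgroup X γ)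
    {K : Subgroup G} (hK : ∀ᶠ t in 𝓝 0, γ t ∈ K) (t : ℝ) : γ t ∈ K := by
  let S : AddSubgroup ℝ :=
    { carrier := {t | γ t ∈ K}
      zero_mem' := by simp [h.1]
      add_mem' := fun {a b} ha hb => by
        change γ (a + b) ∈ K
        rw [h.map_add]; exact K.mul_mem ha hb
      neg_mem' := fun {a} ha => by
        change γ (-a) ∈ K
        rw [h.map_neg]; exact K.inv_mem ha }
  have hopen : IsOpen (S : Set ℝ) := S.isOpen_of_mem_nhds (g := 0) hK
  have hcl : IsClopen (S : Set ℝ) := ⟨S.isClosed_of_isOpen hopen, hopen⟩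
  have := hcl.eq_univ ⟨0, S.zero_mem⟩
  exact (this ▸ mem_univ t : t ∈ (S : Set ℝ))

/-- A one-parameter subgroup commuting with a maximal torus is contained in it. -/
theorem IsOneParameterSubgroup.mem_of_isMaximalTorus [IsTopologicalGroup G] [CompactSpace G]
    (h : IsOneParameterSubgroup X γ) {T K : Subgroup G} (hT : IsMaximalTorus T K)
    (hK : IsClosed (K : Set G)) (hγK : ∀ t, γ t ∈ K)
    (hcomm : ∀ g ∈ T, ∀ t, g * γ t = γ t * g) (t : ℝ) : γ t ∈ T := by
  obtain ⟨⟨hTc, hTconn, hTcomm⟩, hTK⟩ := hT.prop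
  have hγcomm : ∀ s t, γ s * γ t = γ t * γ s := fun s t => by
    rw [← h.map_add, ← h.map_add, add_comm]
  let S : Subgroup G :=
    { carrier := {x | ∃ g ∈ T, ∃ t, x = g * γ t}
      one_mem' := ⟨1, T.one_mem, 0, by simp [h.1]⟩
      mul_mem' := by
        rintro _ _ ⟨g, hg, s, rfl⟩ ⟨g', hg', s', rfl⟩
        refine ⟨g * g', T.mul_mem hg hg', s + s', ?_⟩
        rw [h.map_add, mul_assoc, ← mul_assoc (γ s), ← hcomm g' hg' s]
        simp only [mul_assoc]
      inv_mem' := by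
        rintro _ ⟨g, hg, s, rfl⟩
        refine ⟨g⁻¹, T.inv_mem hg, -s, ?_⟩
        rw [mul_inv_rev, ← h.map_neg, hcomm _ (T.inv_mem hg)] }
  have hSK : S ≤ K := by
    rintro _ ⟨g, hg, s, rfl⟩
    exact K.mul_mem (hTK hg) (hγK s)
  have hScomm : ∀ x y : S, x * y = y * x := by
    rintro ⟨_, g, hg, s, rfl⟩ ⟨_, g', hg', s', rfl⟩
    refine Subtype.ext ?_
    change g * γ s * (g' * γ s') = g' * γ s' * (g * γ s)
    calc g * γ s * (g' * γ s') = (g * g') * (γ s * γ s') := by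
          rw [mul_assoc, ← mul_assoc (γ s), ← hcomm g' hg' s]; simp only [mul_assoc]
      _ = (g' * g) * (γ s' * γ s) := by rw [hTcomm g hg g' hg', hγcomm]
      _ = g' * γ s' * (g * γ s) := by
          rw [mul_assoc g' (γ s'), ← mul_assoc (γ s'), ← hcomm g hg s']; simp only [mul_assoc]
  have hSconn : IsConnected (S : Set G) := by
    have e : (S : Set G) = (fun p : G × ℝ => p.1 * γ p.2) '' ((T : Set G) ×ˢ univ) := by
      ext x
      constructor
      · rintro ⟨g, hg, s, rfl⟩
        exact ⟨(g, s), ⟨hg, trivial⟩, rfl⟩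
      · rintro ⟨⟨g, s⟩, ⟨hg, -⟩, rfl⟩
        exact ⟨g, hg, s, rfl⟩
    rw [e]
    refine (hTconn.prod isConnected_univ).image _ (Continuous.continuousOn ?_)
    exact continuous_fst.mul (h.2.continuous.comp continuous_snd)
  let _ := S.commGroupTopologicalClosure hScomm
  -- The closure of `T · γ(ℝ)` is again a torus in `K` and contains `T`; maximality applies.
  have hST : S.topologicalClosure ≤ T := by
    refine hT.le_of_ge ⟨⟨?_, ?_, ?_⟩, ?_⟩ ?_
    · exact S.isClosed_topologicalClosure.isCompact
    · rw [Subgroup.topologicalClosure_coe]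
      exact hSconn.closure
    · intro x hx y hy
      exact congrArg Subtype.val (mul_comm (⟨x, hx⟩ : S.topologicalClosure) ⟨y, hy⟩)
    · exact S.topologicalClosure_minimal hSK hK
    · exact (show T ≤ S from fun g hg => ⟨g, hg, 0, by simp [h.1]⟩).trans S.le_topologicalClosure
  exact hST (S.le_topologicalClosure ⟨1, T.one_mem, t, by simp⟩)

variable [CompleteSpace E]

/-- The Lie algebra of a maximal torus of a symmetric subgroup. -/
theorem mem_subgroupLieAlgebra_iff_of_isMaximalTorus [IsTopologicalGroup G] [CompactSpace G]
    {σ : G →* G} (hσ : ContMDiff 𝓘(ℝ, E) 𝓘(ℝ, E) ∞ σ) {K : Subgroup G} {U : Set G}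
    (hU : IsOpen U) (hK : (K : Set G) = U ∩ {g | σ g = g}) (hKc : IsClosed (K : Set G))
    {T : Subgroup G} (hT : IsMaximalTorus T K) (X : GroupLieAlgebra 𝓘(ℝ, E) G) :
    X ∈ subgroupLieAlgebra E T ↔ lieDifferential σ X = X ∧ ∀ g ∈ T, adjointAction E g X = X := by
  have hKσ : ∀ g ∈ K, σ g = g := fun g hg => by
    have : g ∈ (K : Set G) := hg
    rw [hK] at this
    exact this.2
  constructor
  · intro hX
    suffices subgroupLieAlgebra E T ≤ adjointFixed σ T from this hX
    refine Submodule.span_le.2 ?_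
    rintro Z ⟨γ, hγ0, hγ, hγT⟩
    have h : IsOneParameterSubgroup Z γ := ⟨hγ0, hγ⟩
    refine ⟨(h.map_eq_iff hσ).2 fun t => hKσ _ (hT.prop.2 (hγT t)), fun g hg => ?_⟩
    refine (h.conj_eq_iff g).2 fun t => ?_
    rw [hT.prop.1.2.2 g hg _ (hγT t), mul_inv_cancel_right]
  · rintro ⟨h1, h2⟩
    obtain ⟨γ, h⟩ := exists_isOneParameterSubgroup X
    have hγσ := (h.map_eq_iff hσ).1 h1
    -- The curve stays in the fixed points of `σ`, and `K` is open in these, so `γ t` lies in `K`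
    -- for small `t`.
    have hγK : ∀ t, γ t ∈ K := by
      refine h.mem_of_eventually_mem ?_
      have h0 : γ 0 ∈ U := by
        have : γ 0 ∈ (K : Set G) := by rw [h.1]; exact K.one_mem
        rw [hK] at this
        exact this.1
      filter_upwards [h.2.continuous.continuousAt.preimage_mem_nhds (hU.mem_nhds h0)] with t ht
      change γ t ∈ (K : Set G)
      rw [hK]
      exact ⟨ht, hγσ t⟩
    refine Submodule.subset_span ⟨γ, h.1, h.2, h.mem_of_isMaximalTorus hT hKc hγK fun g hg t => ?_⟩
    have := (h.conj_eq_iff g).1 (h2 g hg) t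
    rwa [mul_inv_eq_iff_eq_mul] at this

end MaximalTori

/-! ### Centralizers of Lie algebras of tori -/

section Centralizers

open Filter Topology Set NormedSpace

variable {E : Type*} [NormedAddCommGroup E] [NormedSpace ℝ E] [CompleteSpace E]
  {G : Type*} [TopologicalSpace G] [ChartedSpace E G] [Group G] [LieGroup 𝓘(ℝ, E) ∞ G]

variable (E G) in
/-- The Lie bracket of a Lie group as a bilinear map on the model space. -/
def groupBracket : E →ₗ[ℝ] E →ₗ[ℝ] E :=
  LinearMap.mk₂ ℝ (M := GroupLieAlgebra 𝓘(ℝ, E) G) (Nₗ := GroupLieAlgebra 𝓘(ℝ, E) G)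
    (Pₗ := GroupLieAlgebra 𝓘(ℝ, E) G) (fun X Y => ⁅X, Y⁆) add_lie smul_lie lie_add lie_smul

variable [T2Space G]

theorem adjointAction_groupBracket (g : G) (X Y : E) :
    adjointAction E g (groupBracket E G X Y) =
      groupBracket E G (adjointAction E g X) (adjointAction E g Y) :=
  lieDifferential_lie (f := (MulAut.conj g).toMonoidHom) (contMDiff_conj g) X Y

theorem lieDifferential_involutive {σ : G →* G} (hσ : ContMDiff 𝓘(ℝ, E) 𝓘(ℝ, E) ∞ σ)
    (hσσ : ∀ g, σ (σ g) = g) (X : GroupLieAlgebra 𝓘(ℝ, E) G) :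
    lieDifferential σ (lieDifferential σ X) = X := by
  obtain ⟨γ, h⟩ := exists_isOneParameterSubgroup X
  have h1 : IsOneParameterSubgroup (lieDifferential σ (lieDifferential σ X)) (σ ∘ (σ ∘ γ)) :=
    (h.map hσ).map hσ
  have e : σ ∘ (σ ∘ γ) = γ := funext fun t => hσσ _
  rw [e] at h1
  exact h1.velocity_unique h

variable [FiniteDimensional ℝ E]

/-- The generator of a one-parameter group of automorphisms is a derivation. -/
theorem generator_leibniz {D : E →L[ℝ] E} (hD : ∀ s : ℝ, ∃ g : G, adjointAction E g = exp (s • D))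
    (X Y : E) : D (groupBracket E G X Y) =
      groupBracket E G X (D Y) + groupBracket E G (D X) Y := by
  have hexp : ∀ v : E, HasDerivAt (fun s : ℝ => exp (s • D) v) (D v) 0 := fun v => by
    have := (hasDerivAt_exp_smul_const (𝕂 := ℝ) D (0 : ℝ)).clm_apply (hasDerivAt_const (0 : ℝ) v)
    simpa using this
  have h3 := ((groupBracket E G).toContinuousBilinearMap).isBoundedBilinearMap.hasFDerivAt
    (exp ((0 : ℝ) • D) X, exp ((0 : ℝ) • D) Y)
  have h4 := h3.comp_hasDerivAt 0 ((hexp X).prodMk (hexp Y))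
  have h5 : (fun s : ℝ => exp (s • D) (groupBracket E G X Y)) =
      fun s : ℝ => groupBracket E G (exp (s • D) X) (exp (s • D) Y) := funext fun s => by
    obtain ⟨g, hg⟩ := hD s
    rw [← hg, adjointAction_groupBracket]
  have h6 := hexp (groupBracket E G X Y)
  rw [h5] at h6
  have h7 := h6.unique h4
  simpa using! h7

variable [IsTopologicalGroup G] [CompactSpace G] [LieAlgebra.IsKilling ℝ (GroupLieAlgebra 𝓘(ℝ, E) G)]

/-- The Lie algebra of a maximal torus of a symmetric subgroup is its own centralizer in the Lie
algebra of the subgroup. -/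
theorem mem_subgroupLieAlgebra_iff_forall_lie_eq_zero
    {σ : G →* G} (hσ : ContMDiff 𝓘(ℝ, E) 𝓘(ℝ, E) ∞ σ) (hσσ : ∀ g, σ (σ g) = g)
    {K : Subgroup G} {U : Set G}
    (hU : IsOpen U) (hK : (K : Set G) = U ∩ {g | σ g = g}) (hKc : IsClosed (K : Set G))
    {T : Subgroup G} (hT : IsMaximalTorus T K) (X : GroupLieAlgebra 𝓘(ℝ, E) G) :
    X ∈ subgroupLieAlgebra E T ↔
      lieDifferential σ X = X ∧ ∀ W ∈ subgroupLieAlgebra E T, ⁅W, X⁆ = 0 := by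
  have hmem := mem_subgroupLieAlgebra_iff_of_isMaximalTorus hσ hU hK hKc hT
  have hfin : FiniteDimensional ℝ (GroupLieAlgebra 𝓘(ℝ, E) G) :=
    inferInstanceAs (FiniteDimensional ℝ E)
  constructor
  · intro hX
    obtain ⟨h1, h2⟩ := (hmem X).1 hX
    refine ⟨h1, fun W hW => ?_⟩
    induction hW using Submodule.span_induction with
    | mem W hW =>
      obtain ⟨γ, hγ0, hγ, hγT⟩ := hW
      exact IsOneParameterSubgroup.lie_eq_zero ⟨hγ0, hγ⟩ fun s => h2 _ (hγT s)
    | zero => simp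
    | add W W' _ _ hW hW' => rw [add_lie, hW, hW', add_zero]
    | smul c W _ hW => rw [smul_lie, hW, smul_zero]
  · rintro ⟨h1, h2⟩
    refine (hmem X).2 ⟨h1, fun g hg => ?_⟩
    obtain ⟨⟨hTc, hTconn, hTcomm⟩, hTK⟩ := hT.prop
    have hTσ : ∀ g ∈ T, σ g = g := fun g hg => by
      have : g ∈ (K : Set G) := hTK hg
      rw [hK] at this
      exact this.2
    have hcs : CompactSpace T := isCompact_iff_compactSpace.1 hTc
    have hconn : ConnectedSpace T := isConnected_iff_connectedSpace.1 hTconn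
    let ρ : T →* (E →L[ℝ] E) := (adjointRep E G).comp T.subtype
    have hρ : Continuous ρ := continuous_adjointAction.comp continuous_subtype_val
    refine apply_eq_of_forall_generator_apply_eq_zero ρ hρ
      -- It is enough that every generator `D` of a one-parameter subgroup of `Ad T` kills `X`.
      (fun a b => Subtype.ext (hTcomm a a.2 b b.2)) (v := (X : E)) (fun D hD => ?_) ⟨g, hg⟩
    have hD' : ∀ s : ℝ, ∃ g ∈ T, adjointAction E g = exp (s • D) := fun s => by
      obtain ⟨g, hg⟩ := hD s
      exact ⟨g, g.2, hg⟩
    have hleib := generator_leibniz (G := G) fun s => (hD' s).imp fun g hg => hg.2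
    let δ : LieDerivation ℝ (GroupLieAlgebra 𝓘(ℝ, E) G) (GroupLieAlgebra 𝓘(ℝ, E) G) :=
      { toLinearMap := (D : E →ₗ[ℝ] E)
        leibniz' := fun Y Y' => by
          refine (hleib Y Y').trans ?_
          rw [sub_eq_add_neg, lie_skew]
          rfl }
    -- Nondegeneracy of the Killing form makes `D` inner, `D = ad Z`, with `Z` unique because the
    -- centre is trivial.
    obtain ⟨Z, hZ⟩ := LieDerivation.IsKilling.exists_eq_ad δ
    have hDZ : ∀ Y : E, groupBracket E G Z Y = D Y := fun (Y : GroupLieAlgebra 𝓘(ℝ, E) G) =>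
      (congrArg (fun F : Module.End ℝ _ => F Y)
        (LieDerivation.coe_ad_apply_eq_ad_apply Z)).symm.trans (DFunLike.congr_fun hZ Y)
    have hinj : ∀ Z' : GroupLieAlgebra 𝓘(ℝ, E) G, (∀ Y : E, groupBracket E G Z' Y = D Y) → Z' = Z := fun Z' hZ' => by
      have h5 : ((Z' : GroupLieAlgebra 𝓘(ℝ, E) G) - Z : GroupLieAlgebra 𝓘(ℝ, E) G) ∈
          LieAlgebra.center ℝ (GroupLieAlgebra 𝓘(ℝ, E) G) := by
        refine (LieModule.mem_maxTrivSubmodule ..).2 fun Y => ?_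
        rw [← lie_skew, sub_lie, neg_eq_zero, sub_eq_zero]
        exact (hZ' Y).trans (hDZ Y).symm
      rw [LieAlgebra.center_eq_bot] at h5
      exact sub_eq_zero.1 ((LieSubmodule.mem_bot _).1 h5)
    -- `D` commutes with `Ad T` and with the differential of `σ`, so the images of `Z` under these
    -- also induce `D`; by uniqueness they equal `Z`.
    have hZt : (Z : GroupLieAlgebra 𝓘(ℝ, E) G) ∈ subgroupLieAlgebra E T := by
      refine (hmem Z).2 ⟨hinj _ fun Y => ?_, fun g hg => hinj _ fun Y => ?_⟩
      · let θ : E →L[ℝ] E := mfderiv 𝓘(ℝ, E) 𝓘(ℝ, E) σ 1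
        have hc : Commute D θ := commute_of_forall_commute_exp_smul fun s => by
          obtain ⟨g, hg, hg'⟩ := hD' s
          rw [← hg']
          refine ContinuousLinearMap.ext fun Y => ?_
          have := mfderiv_adjointAction hσ g Y
          rw [hTσ g hg] at this
          exact this.symm
        have hθθ : ∀ Y : E, θ (θ Y) = Y := fun Y => lieDifferential_involutive hσ hσσ Y
        have h3 : θ (groupBracket E G Z (θ Y)) = groupBracket E G (θ Z) (θ (θ Y)) :=
          lieDifferential_lie hσ Z (θ Y)
        rw [hθθ, hDZ] at h3
        refine h3.symm.trans ?_
        have h4 : D (θ (θ Y)) = θ (D (θ Y)) := DFunLike.congr_fun hc.eq (θ Y)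
        rw [← h4, hθθ]
      · have hc : Commute D (adjointAction E g) := commute_of_forall_commute_exp_smul fun s => by
          obtain ⟨g', hg', e⟩ := hD' s
          rw [← e]
          change adjointAction E g' * adjointAction E g = adjointAction E g * adjointAction E g'
          rw [← adjointAction_mul, hTcomm g' hg' g hg, adjointAction_mul]
        have h3 := adjointAction_groupBracket (E := E) g Z (adjointAction E g⁻¹ Y)
        rw [hDZ, adjointAction_inv_apply] at h3
        refine h3.symm.trans ?_
        have h4 : D (adjointAction E g (adjointAction E g⁻¹ Y)) =
          adjointAction E g (D (adjointAction E g⁻¹ Y)) := DFunLike.congr_fun hc.eq _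
        rw [← h4, adjointAction_inv_apply]
    exact (hDZ X).symm.trans (h2 Z hZt)

end Centralizers

end

theorem mainTheorem9
    {E : Type*} [NormedAddCommGroup E] [NormedSpace ℝ E] [CompleteSpace E] [FiniteDimensional ℝ E]
    {G : Type*} [TopologicalSpace G] [ChartedSpace E G] [Group G] [LieGroup 𝓘(ℝ, E) ∞ G]
    [T2Space G] [CompactSpace G] [ConnectedSpace G]
    [LieAlgebra.IsSemisimple ℝ (GroupLieAlgebra 𝓘(ℝ, E) G)]
    (K : Subgroup G) (hK : IsSymmetricSubgroup E K)
    (hKcompact : IsCompact (K : Set G)) (hKconn : IsConnected (K : Set G))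
    (TK TG : Subgroup G) (hTK : IsMaximalTorus TK K) (hTG : IsMaximalTorus TG ⊤) (hT : TK ≤ TG) :
    weylChambers (restrictForm (subgroupLieAlgebra_mono (E := E) hT) ''
        realRoots (subgroupLieAlgebra E TG)) =
      compartments (subgroupLieAlgebra_mono (E := E) hT) (realRoots (subgroupLieAlgebra E TG)) ∧
    ∀ C ∈ weylChambers (realRoots (subgroupLieAlgebra E TG)),
      (interSubspace (subgroupLieAlgebra_mono (E := E) hT) C).Nonempty →
      restrictForm (subgroupLieAlgebra_mono (E := E) hT) ''
          simpleRoots (realRoots (subgroupLieAlgebra E TG)) C =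
        simpleRoots (restrictForm (subgroupLieAlgebra_mono (E := E) hT) ''
            realRoots (subgroupLieAlgebra E TG))
          (interSubspace (subgroupLieAlgebra_mono (E := E) hT) C) := by
  have hfin : FiniteDimensional ℝ (GroupLieAlgebra 𝓘(ℝ, E) G) :=
    inferInstanceAs (FiniteDimensional ℝ E)
  have ht2 : T2Space (GroupLieAlgebra 𝓘(ℝ, E) G) := inferInstanceAs (T2Space E)
  have htg : IsTopologicalGroup G := topologicalGroup_of_lieGroup 𝓘(ℝ, E) ∞
  refine ⟨weylChambers_restrictForm_eq_compartments _ _, fun C hC hne => ?_⟩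
  obtain ⟨σ, hσ, hσσ, U, hU, hKU⟩ := hK
  obtain ⟨B, hsymm, hpos, hB⟩ := exists_adjointAction_invariant_inner (E := E) (G := G)
  let D : E →L[ℝ] E := mfderiv 𝓘(ℝ, E) 𝓘(ℝ, E) σ 1
  let θ : GroupLieAlgebra 𝓘(ℝ, E) G →ₗ⁅ℝ⁆ GroupLieAlgebra 𝓘(ℝ, E) G :=
    { toLinearMap := (D : E →ₗ[ℝ] E)
      map_lie' := fun {X Y} => lieDifferential_lie (f := σ.toMonoidHom) hσ X Y }
  refine restrictForm_image_simpleRoots_of_involution _ B hsymm hpos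
    (lie_apply_add_apply_lie_eq_zero hB) (fun X => ?_) θ
    (fun X => lieDifferential_involutive (σ := σ.toMonoidHom) hσ hσσ X)
    (mem_subgroupLieAlgebra_iff_forall_lie_eq_zero (σ := σ.toMonoidHom) hσ hσσ hU hKU
      hKcompact.isClosed hTK) hC hne
  -- The torus `TG` is the case of the symmetric subgroup `⊤` with `σ` the identity.
  have h := mem_subgroupLieAlgebra_iff_forall_lie_eq_zero (E := E) (σ := MonoidHom.id G) contMDiff_id
    (fun _ => rfl) (K := ⊤) (U := Set.univ) isOpen_univ (by simp) isClosed_univ hTG X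
  have hid : lieDifferential (E := E) (MonoidHom.id G) X = X :=
    DFunLike.congr_fun (mfderiv_id (I := 𝓘(ℝ, E)) (x := (1 : G))) X
  rw [h]
  exact and_iff_right hid
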